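/- Let $r,s\ge 0$ and $c\ge 1$ be integers and put $d=\gcd(r,s)$ (with $\gcd(0,0)=0$). Let $F$ be the free group on $\{x,y\}$, with lower central series $\gamma_1(F)=F$, $\gamma_{n+1}(F)=[\gamma_n(F),F]$. Let $S$ be the normal closure of $\{x^r,y^s\}$ in $F$, and put $\rho_1(S)=S$, $\rho_{n+1}(S)=[\rho_n(S),F]$, so that $\rho_{c+1}(S)=[S,F,\dots,F]$ with $c$ copies of $F$. Let $r(n)$ denote the number of basic commutators of weight $n$ on two letters. (i) The subgroup $\gamma_{c+2}(F)\rho_{c+1}(S)/\gamma_{c+2}(F)$ of $\gamma_{c+1}(F)/\gamma_{c+2}(F)$ is the direct sum $d\mathbb Z\oplus\cdots\oplus d\mathbb Z$ of $r(c+1)$ copies of $d\mathbb Z$. (ii) Suppose that either $j=3$ and $r,s$ are odd; or $j=4$ and neither $2$ nor $3$ divides $r$ or $s$; or $j=5$, $c\ge 3$, and neither $2$ nor $3$ divides $r$ or $s$. Then the subgroup $\gamma_{c+j}(F)\rho_{c+1}(S)/\gamma_{c+j}(F)$ of $\gamma_{c+1}(F)/\gamma_{c+j}(F)$ is the direct sum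 $d\mathbb Z\oplus\cdots\oplus d\mathbb Z$ of $\sum_{i=1}^{j-1}r(c+i)$ copies of $d\mathbb Z$. Here "the subgroup $H$ of $A$ is the direct sum of $N$ copies of $d\mathbb Z$" means that there is an isomorphism $A\cong\mathbb Z^N$ carrying $H$ onto $(d\mathbb Z)^N$; in particular, $H\cong(d\mathbb Z)^N$. -/

import Mathlib

/-- The term `γ_n(G)` (`n ≥ 1`) of the lower central series, numbered so that `γ_1(G) = G` and
`γ_{n+1}(G) = [γ_n(G), G]`. (Mathlib starts the series at index `0`.) -/
abbrev gamma (G : Type*) [Group G] (n : ℕ) : Subgroup G :=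
  (⊤ : Subgroup G).lowerCentralSeries (n - 1)

/-- The subgroup `[S, G, …, G]` with `c` copies of `G`. -/
def iteratedCommutator {G : Type*} [Group G] (S : Subgroup G) : ℕ → Subgroup G
  | 0 => S
  | c + 1 => ⁅iteratedCommutator S c, (⊤ : Subgroup G)⁆

/-- `ρ_n(S) = [S, G, …, G]` with `n - 1` copies of `G` (`n ≥ 1`), so that `ρ_1(S) = S`. -/
abbrev rho {G : Type*} [Group G] (S : Subgroup G) (n : ℕ) : Subgroup G :=
  iteratedCommutator S (n - 1)

/-- The free group `F` on two letters `x`, `y`. -/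
abbrev F2 : Type := FreeGroup (Fin 2)

/-- The letter `x` of the free group. -/
abbrev F2.x : F2 := FreeGroup.of 0

/-- The letter `y` of the free group. -/
abbrev F2.y : F2 := FreeGroup.of 1

/-- The normal closure `S` of `x ^ r` and `y ^ s` in the free group on `x`, `y`. -/
abbrev powerClosure (r s : ℕ) : Subgroup F2 := Subgroup.normalClosure {F2.x ^ r, F2.y ^ s}

/-- The subgroup `γ_n(G) T / γ_n(G)` of `G / γ_n(G)`. -/
abbrev modGamma {G : Type*} [Group G] (n : ℕ) (T : Subgroup G) : Subgroup (G ⧸ gamma G n) :=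
  (gamma G n ⊔ T).map (QuotientGroup.mk' (gamma G n))

/-- The order of formal commutators used in the definition of basic commutators: smaller weight
comes first, letters keep the order of the alphabet, and formal commutators of equal weight are
ordered lexicographically. A formal commutator is an element of the free magma on the letters
(`u * v` stands for `[u, v]`), and its weight is its `length`. -/
def CommLT {α : Type*} [LT α] : FreeMagma α → FreeMagma α → Prop
  | .of a, .of b => a < b
  | .of _, .mul _ _ => True
  | .mul _ _, .of _ => False
  | .mul u v, .mul u' v' =>
      (u * v).length < (u' * v').length ∨
        ((u * v).length = (u' * v').length ∧ (CommLT u u' ∨ (u = u' ∧ CommLT v v')))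

/-- Basic commutators (P. Hall, M. Hall): every letter is basic, and `[u, v]` is basic when `u`
and `v` are basic, `u > v`, and, if `u = [p, q]`, also `v ≥ q`. -/
def IsBasicCommutator {α : Type*} [LT α] : FreeMagma α → Prop
  | .of _ => True
  | .mul u v => IsBasicCommutator u ∧ IsBasicCommutator v ∧ CommLT v u ∧
      ∀ p q : FreeMagma α, u = p * q → (q = v ∨ CommLT q v)

/-- The number of basic commutators of weight `n` on two letters. -/
noncomputable def numBasic (n : ℕ) : ℕ :=
  {t : FreeMagma (Fin 2) | IsBasicCommutator t ∧ t.length = n}.ncard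

/-- There are only finitely many formal commutators of a given weight on two letters, so that
`numBasic n` is a genuine count. -/
theorem finite_basic (n : ℕ) :
    {t : FreeMagma (Fin 2) | IsBasicCommutator t ∧ t.length = n}.Finite := by
  have key : ∀ m : ℕ, {t : FreeMagma (Fin 2) | t.length ≤ m}.Finite := by
    intro m
    induction m with
    | zero =>
      refine Set.Finite.subset Set.finite_empty ?_
      intro t ht
      have := t.length_pos
      simp only [Set.mem_setOf_eq] at ht
      omega
    | succ m ih =>
      refine Set.Finite.subset
        ((Set.finite_range (FreeMagma.of : Fin 2 → FreeMagma (Fin 2))).union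
          (Set.Finite.image2 (· * ·) ih ih)) ?_
      intro t ht
      cases t with
      | of a => exact Or.inl ⟨a, rfl⟩
      | mul u v =>
        have hu := u.length_pos
        have hv := v.length_pos
        have h : u.length + v.length ≤ m + 1 := ht
        exact Or.inr ⟨u, by simp only [Set.mem_setOf_eq]; omega, v,
          by simp only [Set.mem_setOf_eq]; omega, rfl⟩
  exact (key n).subset fun t ht => le_of_eq ht.2

/-- `H` is the direct sum `dℤ ⊕ … ⊕ dℤ` (`N` copies) inside the free abelian group `A` of
rank `N`: some isomorphism of `A` with `ℤ ^ N` carries `H` onto `(dℤ) ^ N`; in particular `H` is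
isomorphic to `(dℤ) ^ N`. -/
def IsSumOfMultiples {G : Type*} [Group G] (A H : Subgroup G) (d N : ℕ) : Prop :=
  Nonempty (H ≃* Multiplicative (Fin N → AddSubgroup.zmultiples (d : ℤ))) ∧
  H ≤ A ∧ ∃ e : A ≃* Multiplicative (Fin N → ℤ),
    ∀ g : A, (g : G) ∈ H ↔ ∀ i, (e g).toAdd i ∈ AddSubgroup.zmultiples (d : ℤ)

/-! Put d = gcd(r, s). In each case A = γ_{c+1}/γ_{c+j} is abelian, and Hall's basis theorem makes
it free abelian on the basic commutators of weights c+1, …, c+j-1. It remains to see that the image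
of ρ_{c+1}(S) in A is exactly dA (`mem_rho_iff_exists_smul`).

Hall's theorem has two halves. Basic commutators of weight n generate γ_n modulo γ_{n+1} by
rewriting with the Hall–Witt identity (`gamma_le_spanMod_basic`). They are independent because the
Magnus map a ↦ 1 + at turns commutators into Lie brackets of leading coefficients, and the basic Lie
brackets are independent in the free associative algebra (`linearIndependent_lieEval`). The latter
is a count: eliminating basic commutators one at a time rewrites the words of degree n in the
letters as no more collected words with at least the same span.

The image lies in dA: S is contained in the normal closure of the d-th powers, and commutation with
F sends d-th powers from γ_i to d-th powers from γ_{i+1}, modulo j - 1 steps further down the series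
(`gammaPower_commutator_le`). This needs an explicit Hall–Petrescu formula for (ba)^d; the
coprimality assumptions make d divide its exponents.

The image contains dA: modulo γ_3, [x,y]^r and [x,y]^s lie in [S,F], hence so does [x,y]^d;
bilinearity carries this to every weight modulo the next term (`pow_gcd_mem_iteratedCommutator`).
The errors in higher weight are absorbed because the image already lies in dA and the quotients of
the filtration are torsion-free (`IsFilteredBasis.smul_mem`). -/

/-! ### The lower central series and commutators modulo a normal subgroup. -/

section Gamma

open scoped commutatorElement

variable {G : Type*} [Group G]

theorem gamma_succ {n : ℕ} (hn : 1 ≤ n) : gamma G (n + 1) = ⁅gamma G n, (⊤ : Subgroup G)⁆ := by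
  obtain ⟨m, rfl⟩ := Nat.exists_eq_add_of_le' hn
  exact Subgroup.lowerCentralSeries_succ _ m

theorem gamma_one : gamma G 1 = ⊤ := rfl

theorem gamma_antitone : Antitone (gamma G) := fun _ _ h =>
  Subgroup.lowerCentralSeries_antitone _ (Nat.sub_le_sub_right h 1)

theorem commutator_commutator_le_of_rotate {H₁ H₂ H₃ N : Subgroup G} [N.Normal]
    (h1 : ⁅⁅H₂, H₃⁆, H₁⁆ ≤ N) (h2 : ⁅⁅H₃, H₁⁆, H₂⁆ ≤ N) : ⁅⁅H₁, H₂⁆, H₃⁆ ≤ N := by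
  have key : ∀ K : Subgroup G, K ≤ N ↔ K.map (QuotientGroup.mk' N) = ⊥ := by
    intro K
    rw [Subgroup.map_eq_bot_iff, QuotientGroup.ker_mk']
  rw [key] at h1 h2 ⊢
  simp only [Subgroup.map_commutator] at h1 h2 ⊢
  exact Subgroup.commutator_commutator_eq_bot_of_rotate h1 h2

theorem gamma_commutator_le (a b : ℕ) : ⁅gamma G a, gamma G b⁆ ≤ gamma G (a + b) := by
  induction b generalizing a with
  -- Truncated subtraction gives `gamma G 0 = ⊤`, so index 0 only asks for normality of the other
  -- term.
  | zero => exact Subgroup.commutator_le_left _ _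
  | succ b ih =>
    rcases Nat.eq_zero_or_pos a with rfl | ha
    · rw [zero_add]
      exact Subgroup.commutator_le_right _ _
    rcases Nat.eq_zero_or_pos b with rfl | hb
    · exact (gamma_succ ha).ge
    rw [gamma_succ hb, Subgroup.commutator_comm]
    apply commutator_commutator_le_of_rotate
    · rw [Subgroup.commutator_comm ⊤, ← gamma_succ ha]
      exact (ih (a + 1)).trans (gamma_antitone (by omega))
    · refine (Subgroup.commutator_mono (ih a) le_rfl).trans ?_
      rw [← gamma_succ (by omega)]
      exact gamma_antitone (by omega)

theorem commutator_mem_gamma {a b n : ℕ} {g h : G} (hg : g ∈ gamma G a) (hh : h ∈ gamma G b)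
    (hn : n ≤ a + b) : ⁅g, h⁆ ∈ gamma G n :=
  gamma_antitone hn (gamma_commutator_le a b (Subgroup.commutator_mem_commutator hg hh))

theorem commutator_mem_gamma_succ {a : ℕ} {g : G} (hg : g ∈ gamma G a) (h : G) :
    ⁅g, h⁆ ∈ gamma G (a + 1) :=
  commutator_mem_gamma (b := 1) hg (Subgroup.mem_top h) le_rfl

/-- γ_n is central modulo γ_{n+1}, so every subgroup in between is normal. -/
theorem normal_of_gamma_le {n : ℕ} {T : Subgroup G} (h₁ : gamma G (n + 1) ≤ T)
    (h₂ : T ≤ gamma G n) : T.Normal := by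
  rw [← Subgroup.commutator_top_right_le_iff, Subgroup.commutator_le]
  intro a ha b _
  exact h₁ (commutator_mem_gamma_succ (h₂ ha) b)

theorem commute_mk_iff (T : Subgroup G) [T.Normal] (a q : G) :
    Commute (a : G ⧸ T) (q : G ⧸ T) ↔ ⁅a, q⁆ ∈ T := by
  rw [← commutatorElement_eq_one_iff_commute, ← QuotientGroup.eq_one_iff]
  rfl

/-- The elements that commute with `q` modulo `T`. -/
def centralizerMod (T : Subgroup G) [T.Normal] (q : G) : Subgroup G :=
  (Subgroup.centralizer {(q : G ⧸ T)}).comap (QuotientGroup.mk' T)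

/-- Since `centralizerMod T q` is a subgroup, `⁅a, q⁆ ∈ T` need only be checked for `a` in a
generating set. -/
theorem mem_centralizerMod {T : Subgroup G} [T.Normal] {q a : G} :
    a ∈ centralizerMod T q ↔ ⁅a, q⁆ ∈ T := by
  rw [← commute_mk_iff, centralizerMod, Subgroup.mem_comap, Subgroup.mem_centralizer_singleton_iff]
  rfl

theorem commutator_mem_comm {T : Subgroup G} {a q : G} : ⁅a, q⁆ ∈ T ↔ ⁅q, a⁆ ∈ T := by
  rw [← inv_mem_iff, commutatorElement_inv]

/-- An element form of the Hall–Witt identity: if `[p, v]` commutes with `q` and `[q, v]` with `p`,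
then `[p, q]` commutes with `v`, provided that commutators of higher weight vanish. -/
theorem commute_commutator_of_rotate {p q v : G} (h₁ : Commute ⁅p, v⁆ q) (h₂ : Commute ⁅q, v⁆ p)
    (h₃ : Commute ⁅p, v⁆ ⁅q, v⁆) (h₄ : Commute ⁅p, q⁆ ⁅p, v⁆) (h₅ : Commute ⁅p, q⁆ ⁅q, v⁆) :
    Commute ⁅p, q⁆ v := by
  have hpv : p * v = ⁅p, v⁆ * v * p := by group
  have hqv : q * v = ⁅q, v⁆ * v * q := by group
  have hpq : p * q = ⁅p, q⁆ * (q * p) := by group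
  generalize ⁅p, v⁆ = A at *
  generalize ⁅q, v⁆ = B at *
  generalize ⁅p, q⁆ = C at *
  -- Moving `v` to the left past `p * q` or past `q * p` costs the same factor `A * B`. As `p * q =
  -- C * (q * p)`, it follows that `C` commutes with `A * B * v`, hence with `v`.
  have e₁ : p * q * v = A * B * v * (p * q) := by
    rw [mul_assoc, hqv, ← mul_assoc, ← mul_assoc, ← h₂.eq, mul_assoc B, hpv, h₃.eq]
    group
  have e₂ : q * p * v = A * B * v * (q * p) := by
    rw [mul_assoc, hpv, ← mul_assoc, ← mul_assoc, ← h₁.eq, mul_assoc A, hqv]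
    group
  have e₃ : C * (A * B * v) = A * B * v * C := by
    rw [hpq, mul_assoc, e₂, ← mul_assoc, ← mul_assoc (A * B * v)] at e₁
    exact mul_right_cancel e₁
  have hAB : Commute C (A * B) := h₄.mul_right h₅
  have : A * B * (C * v) = A * B * (v * C) := by
    rw [← mul_assoc, ← hAB.eq, mul_assoc, e₃, mul_assoc]
  exact mul_left_cancel this

theorem commutator_mem_of_rotate {T : Subgroup G} [T.Normal] {p q v : G} (h₁ : ⁅⁅p, v⁆, q⁆ ∈ T)
    (h₂ : ⁅⁅q, v⁆, p⁆ ∈ T) (h₃ : ⁅⁅p, v⁆, ⁅q, v⁆⁆ ∈ T) (h₄ : ⁅⁅p, q⁆, ⁅p, v⁆⁆ ∈ T)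
    (h₅ : ⁅⁅p, q⁆, ⁅q, v⁆⁆ ∈ T) : ⁅⁅p, q⁆, v⁆ ∈ T := by
  rw [← commute_mk_iff] at *
  exact commute_commutator_of_rotate (p := (p : G ⧸ T)) (q := (q : G ⧸ T)) (v := (v : G ⧸ T))
    h₁ h₂ h₃ h₄ h₅

end Gamma

/-! ### The linear order on formal commutators. -/

section Order

variable {α : Type*}

theorem FreeMagma.mul_inj {u v u' v' : FreeMagma α} : u * v = u' * v' ↔ u = u' ∧ v = v' := by
  constructor
  · intro h
    injection h with h₁ h₂
    exact ⟨h₁, h₂⟩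
  · rintro ⟨rfl, rfl⟩
    rfl

theorem FreeMagma.length_mul (u v : FreeMagma α) : (u * v).length = u.length + v.length := rfl

theorem FreeMagma.finite_length_le [Finite α] (m : ℕ) :
    {t : FreeMagma α | t.length ≤ m}.Finite := by
  induction m with
  | zero =>
    refine Set.finite_empty.subset fun t ht => ?_
    have := t.length_pos
    simp only [Set.mem_ofPred_eq] at ht
    omega
  | succ m ih =>
    refine ((Set.finite_range FreeMagma.of).union (Set.Finite.image2 (· * ·) ih ih)).subset ?_
    intro t ht
    cases t with
    | of a => exact Or.inl ⟨a, rfl⟩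
    | mul u v =>
      have hu := u.length_pos
      have hv := v.length_pos
      have h : u.length + v.length ≤ m + 1 := ht
      exact Or.inr ⟨u, by simp only [Set.mem_ofPred_eq]; omega, v,
        by simp only [Set.mem_ofPred_eq]; omega, rfl⟩

variable [LinearOrder α]

theorem commLT_mul {u v u' v' : FreeMagma α} : CommLT (u * v) (u' * v') ↔
    (u * v).length < (u' * v').length ∨
      ((u * v).length = (u' * v').length ∧ (CommLT u u' ∨ (u = u' ∧ CommLT v v'))) := by
  change CommLT (FreeMagma.mul u v) (FreeMagma.mul u' v') ↔ _
  rw [CommLT]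

theorem commLT_irrefl (t : FreeMagma α) : ¬ CommLT t t := by
  induction t using FreeMagma.recOnMul with
  | ih1 a => simp [CommLT]
  | ih2 u v hu hv =>
    rw [commLT_mul]
    simp [hu, hv]

theorem commLT_trans {t u v : FreeMagma α} (h₁ : CommLT t u) (h₂ : CommLT u v) : CommLT t v := by
  induction t using FreeMagma.recOnMul generalizing u v with
  | ih1 a =>
    cases u <;> cases v <;> simp only [CommLT] at *
    exact h₁.trans h₂
  | ih2 t₁ t₂ ih₁ ih₂ =>
    cases u with
    | of b => exact h₁.elim
    | mul u₁ u₂ =>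
      cases v with
      | of b => exact h₂.elim
      | mul v₁ v₂ =>
        simp only [FreeMagma.mul_eq, commLT_mul] at *
        rcases h₁ with h₁ | ⟨e₁, h₁⟩ <;> rcases h₂ with h₂ | ⟨e₂, h₂⟩
        · left; omega
        · left; omega
        · left; omega
        · refine Or.inr ⟨e₁.trans e₂, ?_⟩
          rcases h₁ with h₁ | ⟨rfl, h₁⟩ <;> rcases h₂ with h₂ | ⟨rfl, h₂⟩
          · exact Or.inl (ih₁ h₁ h₂)
          · exact Or.inl h₁
          · exact Or.inl h₂
          · exact Or.inr ⟨rfl, ih₂ h₁ h₂⟩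

theorem commLT_trichotomous (t u : FreeMagma α) : CommLT t u ∨ t = u ∨ CommLT u t := by
  induction t using FreeMagma.recOnMul generalizing u with
  | ih1 a =>
    cases u with
    | of b =>
      simp only [CommLT]
      rcases lt_trichotomy a b with h | rfl | h
      · exact Or.inl h
      · exact Or.inr (Or.inl rfl)
      · exact Or.inr (Or.inr h)
    | mul u₁ u₂ => simp [CommLT]
  | ih2 t₁ t₂ ih₁ ih₂ =>
    cases u with
    | of b => exact Or.inr (Or.inr trivial)
    | mul u₁ u₂ =>
      simp only [FreeMagma.mul_eq, commLT_mul, FreeMagma.mul_inj]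
      rcases lt_trichotomy (t₁ * t₂).length (u₁ * u₂).length with h | h | h
      · exact Or.inl (Or.inl h)
      · rcases ih₁ u₁ with h₁ | rfl | h₁
        · exact Or.inl (Or.inr ⟨h, Or.inl h₁⟩)
        · rcases ih₂ u₂ with h₂ | rfl | h₂
          · exact Or.inl (Or.inr ⟨h, Or.inr ⟨rfl, h₂⟩⟩)
          · exact Or.inr (Or.inl ⟨rfl, rfl⟩)
          · exact Or.inr (Or.inr (Or.inr ⟨h.symm, Or.inr ⟨rfl, h₂⟩⟩))
        · exact Or.inr (Or.inr (Or.inr ⟨h.symm, Or.inl h₁⟩))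
      · exact Or.inr (Or.inr (Or.inl h))

open scoped Classical in
/-- The linear order on formal commutators given by `CommLT`. -/
noncomputable instance FreeMagma.linearOrder : LinearOrder (FreeMagma α) where
  le t u := t = u ∨ CommLT t u
  lt := CommLT
  le_refl t := Or.inl rfl
  le_trans := by
    rintro t u v (rfl | h₁) (rfl | h₂)
    · exact Or.inl rfl
    · exact Or.inr h₂
    · exact Or.inr h₁
    · exact Or.inr (commLT_trans h₁ h₂)
  lt_iff_le_not_ge t u := by
    constructor
    · intro h
      refine ⟨Or.inr h, ?_⟩
      rintro (rfl | h')
      · exact commLT_irrefl _ h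
      · exact commLT_irrefl _ (commLT_trans h h')
    · rintro ⟨rfl | h, h'⟩
      · exact (h' (Or.inl rfl)).elim
      · exact h
  le_antisymm := by
    rintro t u (rfl | h) (h' | h')
    · rfl
    · rfl
    · exact h'.symm
    · exact (commLT_irrefl _ (commLT_trans h h')).elim
  le_total t u := by
    rcases commLT_trichotomous t u with h | h | h
    · exact Or.inl (Or.inr h)
    · exact Or.inl (Or.inl h)
    · exact Or.inr (Or.inr h)
  toDecidableLE := Classical.decRel _

theorem FreeMagma.lt_of_length_lt {t u : FreeMagma α} (h : t.length < u.length) : t < u := by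
  change CommLT t u
  cases t with
  | of a =>
    cases u with
    | of b => exact (lt_irrefl _ h).elim
    | mul u₁ u₂ => trivial
  | mul t₁ t₂ =>
    cases u with
    | of b =>
      have h₁ := t₁.length_pos
      have h₂ := t₂.length_pos
      have h₃ : t₁.length + t₂.length < 1 := h
      omega
    | mul u₁ u₂ => exact commLT_mul.2 (Or.inl h)

theorem FreeMagma.length_le_of_le {t u : FreeMagma α} (h : t ≤ u) : t.length ≤ u.length :=
  not_lt.1 fun h' => (FreeMagma.lt_of_length_lt h').not_ge h

theorem FreeMagma.lt_mul_left (u v : FreeMagma α) : u < u * v :=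
  FreeMagma.lt_of_length_lt (by have := v.length_pos; rw [FreeMagma.length_mul]; omega)

theorem FreeMagma.lt_mul_right (u v : FreeMagma α) : v < u * v :=
  FreeMagma.lt_of_length_lt (by have := u.length_pos; rw [FreeMagma.length_mul]; omega)

theorem isBasicCommutator_mul {u v : FreeMagma α} : IsBasicCommutator (u * v) ↔
    IsBasicCommutator u ∧ IsBasicCommutator v ∧ v < u ∧ ∀ p q, u = p * q → q ≤ v := by
  change IsBasicCommutator (FreeMagma.mul u v) ↔ _
  rw [IsBasicCommutator]
  rfl

end Order

/-! ### Basic commutators generate each γ_n modulo γ_{n+1}. -/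

section Spanning

open scoped commutatorElement

variable {α : Type*} {G : Type*} [Group G]

/-- The value of a formal commutator in a group. -/
def groupEval (f : α → G) : FreeMagma α → G
  | .of a => f a
  | .mul u v => ⁅groupEval f u, groupEval f v⁆

theorem groupEval_mul (f : α → G) (u v : FreeMagma α) :
    groupEval f (u * v) = ⁅groupEval f u, groupEval f v⁆ := rfl

theorem groupEval_mem_gamma (f : α → G) (t : FreeMagma α) :
    groupEval f t ∈ gamma G t.length := by
  induction t using FreeMagma.recOnMul with
  | ih1 a => exact Subgroup.mem_top _
  | ih2 u v hu hv => exact commutator_mem_gamma hu hv le_rfl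

/-- The subgroup generated by the values of a set of formal commutators and by `γ_{n+1}(G)`. -/
def spanMod (f : α → G) (n : ℕ) (B : Set (FreeMagma α)) : Subgroup G :=
  Subgroup.closure (groupEval f '' B) ⊔ gamma G (n + 1)

theorem spanMod_mono (f : α → G) (n : ℕ) {B C : Set (FreeMagma α)} (h : B ⊆ C) :
    spanMod f n B ≤ spanMod f n C :=
  sup_le_sup_right (Subgroup.closure_mono (Set.image_mono h)) _

theorem groupEval_mem_spanMod (f : α → G) (n : ℕ) {B : Set (FreeMagma α)} {t : FreeMagma α}
    (h : t ∈ B) : groupEval f t ∈ spanMod f n B :=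
  Subgroup.mem_sup_left (Subgroup.subset_closure ⟨t, h, rfl⟩)

theorem spanMod_le_iff {f : α → G} {n : ℕ} {B : Set (FreeMagma α)} {H : Subgroup G} :
    spanMod f n B ≤ H ↔ (∀ t ∈ B, groupEval f t ∈ H) ∧ gamma G (n + 1) ≤ H := by
  rw [spanMod, sup_le_iff, Subgroup.closure_le, Set.image_subset_iff]
  rfl

theorem gamma_le_spanMod (f : α → G) (n : ℕ) (B : Set (FreeMagma α)) :
    gamma G (n + 1) ≤ spanMod f n B := le_sup_right

theorem spanMod_normal (f : α → G) {n : ℕ} {B : Set (FreeMagma α)}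
    (hB : ∀ t ∈ B, t.length = n) : (spanMod f n B).Normal := by
  refine normal_of_gamma_le le_sup_right
    (spanMod_le_iff.2 ⟨fun t ht => ?_, gamma_antitone n.le_succ⟩)
  rw [← hB t ht]
  exact groupEval_mem_gamma f t

variable [LinearOrder α]

/-- The basic commutators of weight `n`. -/
def basicOfWeight (α : Type*) [LinearOrder α] (n : ℕ) : Set (FreeMagma α) :=
  {t | IsBasicCommutator t ∧ t.length = n}

/-- The basic commutators of weight `n` of the form `[p, q]` with `v ≤ q`. -/
def basicOfWeightFrom (n : ℕ) (v : FreeMagma α) : Set (FreeMagma α) :=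
  {t | IsBasicCommutator t ∧ t.length = n ∧ ∃ p q, t = p * q ∧ v ≤ q}

theorem basicOfWeightFrom_anti (n : ℕ) {v v' : FreeMagma α} (h : v ≤ v') :
    basicOfWeightFrom n v' ⊆ basicOfWeightFrom n v := by
  rintro t ⟨h₁, h₂, p, q, h₃, h₄⟩
  exact ⟨h₁, h₂, p, q, h₃, h.trans h₄⟩

theorem basicOfWeightFrom_subset (n : ℕ) (v : FreeMagma α) :
    basicOfWeightFrom n v ⊆ basicOfWeight α n := fun _ h => ⟨h.1, h.2.1⟩

/-- If [u, v] is not basic, then u = [p, q] with q > v, and Hall–Witt reduces [[p, q], v] to [[p,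
v], q] and [[q, v], p]. The inner brackets have smaller weight; expanded into basic commutators w >
v, they leave brackets whose two entries both exceed v. So the smaller entry has grown. -/
theorem commutator_mem_spanMod_of_lt [Finite α] (f : α → G) (n : ℕ) (u v : FreeMagma α)
    (hu : IsBasicCommutator u) (hv : IsBasicCommutator v) (huv : v < u)
    (hn : u.length + v.length = n) :
    ⁅groupEval f u, groupEval f v⁆ ∈ spanMod f n (basicOfWeightFrom n v) := by
  induction n using Nat.strong_induction_on generalizing u v with
  | _ n ihn =>
  -- Inner induction for fixed weight: the number of formal commutators of weight at most `n` above
  -- `v` is finite and drops when `v` grows.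
  induction hk : {w : FreeMagma α | w.length ≤ n ∧ v < w}.ncard using Nat.strong_induction_on
    generalizing u v with
  | _ k ihk =>
  have ihv : ∀ u' v' : FreeMagma α, IsBasicCommutator u' → IsBasicCommutator v' → v' < u' →
      u'.length + v'.length = n → v < v' →
      ⁅groupEval f u', groupEval f v'⁆ ∈ spanMod f n (basicOfWeightFrom n v) := by
    intro u' v' hu' hv' huv' hn' hlt
    refine spanMod_mono f n (basicOfWeightFrom_anti n hlt.le) (ihk _ ?_ u' v' hu' hv' huv' hn' rfl)
    rw [← hk]
    apply Set.ncard_lt_ncard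
    · refine ⟨fun w hw => ⟨hw.1, hlt.trans hw.2⟩, fun h => ?_⟩
      exact lt_irrefl v' (h ⟨by omega, hlt⟩ : v'.length ≤ n ∧ v' < v').2
    · exact (FreeMagma.finite_length_le n).subset fun w hw => hw.1
  have direct : (∀ p q, u = p * q → q ≤ v) →
      ⁅groupEval f u, groupEval f v⁆ ∈ spanMod f n (basicOfWeightFrom n v) := fun h =>
    groupEval_mem_spanMod f n (t := u * v)
      ⟨isBasicCommutator_mul.2 ⟨hu, hv, huv, h⟩, hn, u, v, rfl, le_rfl⟩
  cases u with
  | of a => exact direct fun p q h => by cases h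
  | mul p q =>
  rw [FreeMagma.mul_eq] at *
  by_cases hqv : q ≤ v
  · exact direct fun p' q' h => (FreeMagma.mul_inj.1 h).2 ▸ hqv
  rw [not_le] at hqv
  obtain ⟨hp, hq, hqp, -⟩ := isBasicCommutator_mul.1 hu
  rw [FreeMagma.length_mul] at hn
  have lp := p.length_pos
  have lq := q.length_pos
  have lv := v.length_pos
  have : (spanMod f n (basicOfWeightFrom n v)).Normal :=
    spanMod_normal f fun t ht => ht.2.1
  have step : ∀ p' q' : FreeMagma α, IsBasicCommutator p' → IsBasicCommutator q' → v < p' →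
      v < q' → p'.length + q'.length + v.length = n →
      ⁅⁅groupEval f p', groupEval f v⁆, groupEval f q'⁆ ∈
        spanMod f n (basicOfWeightFrom n v) := by
    intro p' q' hp' hq' hvp' hvq' hn'
    have lp' := p'.length_pos
    have lq' := q'.length_pos
    have h₁ := ihn (p'.length + v.length) (by omega) p' v hp' hv hvp' rfl
    rw [← mem_centralizerMod]
    refine (spanMod_le_iff.2 ⟨?_, ?_⟩ : spanMod f _ _ ≤ _) h₁
    · rintro w ⟨hw, lw, w₁, w₂, rfl, hvw⟩
      rw [mem_centralizerMod]
      have hvw' : v < w₁ * w₂ := hvw.trans_lt (FreeMagma.lt_mul_right _ _)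
      rcases lt_trichotomy q' (w₁ * w₂) with h | h | h
      · exact ihv _ _ hw hq' h (by omega) hvq'
      · rw [← h, commutatorElement_self]
        exact one_mem _
      · rw [commutator_mem_comm]
        exact ihv _ _ hq' hw h (by omega) hvw'
    · intro g hg
      rw [mem_centralizerMod]
      exact gamma_le_spanMod f n _ (commutator_mem_gamma hg (groupEval_mem_gamma f q') (by omega))
  have hhigh : ∀ {a b : ℕ} {g h : G}, g ∈ gamma G a → h ∈ gamma G b → n + 1 ≤ a + b →
      ⁅g, h⁆ ∈ spanMod f n (basicOfWeightFrom n v) := fun hg hh hab =>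
    gamma_le_spanMod f n _ (commutator_mem_gamma hg hh hab)
  have mp := groupEval_mem_gamma f p
  have mq := groupEval_mem_gamma f q
  have mv := groupEval_mem_gamma f v
  rw [groupEval_mul]
  have mpv := commutator_mem_gamma mp mv le_rfl
  have mqv := commutator_mem_gamma mq mv le_rfl
  have mpq := commutator_mem_gamma mp mq le_rfl
  -- The last three conditions hold because those brackets have weight above `n`.
  refine commutator_mem_of_rotate ?_ ?_ ?_ ?_ ?_
  · exact step p q hp hq (hqv.trans hqp) hqv (by omega)
  · exact step q p hq hp hqv (hqv.trans hqp) (by omega)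
  · exact hhigh mpv mqv (by omega)
  · exact hhigh mpq mpv (by omega)
  · exact hhigh mpq mqv (by omega)

theorem gamma_le_spanMod_basic [Finite α] (f : α → G) (hf : Subgroup.closure (Set.range f) = ⊤)
    (n : ℕ) (hn : 1 ≤ n) : gamma G n ≤ spanMod f n (basicOfWeight α n) := by
  induction n, hn using Nat.le_induction with
  | base =>
    rw [gamma_one, ← hf, Subgroup.closure_le]
    rintro _ ⟨a, rfl⟩
    exact groupEval_mem_spanMod f 1 (t := FreeMagma.of a) ⟨trivial, rfl⟩
  | succ n hn ih =>
    have : (spanMod f (n + 1) (basicOfWeight α (n + 1))).Normal :=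
      spanMod_normal f fun t ht => ht.2
    rw [gamma_succ hn, Subgroup.commutator_le]
    intro a ha q _
    -- Modulo γ_{n+2} the commutator is bilinear on γ_n × G, which leaves the brackets of a basic
    -- commutator with a letter.
    rw [← mem_centralizerMod]
    refine (ih.trans (spanMod_le_iff.2 ⟨?_, ?_⟩)) ha
    · rintro b ⟨hb, lb⟩
      rw [mem_centralizerMod, commutator_mem_comm, ← mem_centralizerMod]
      have hq : q ∈ Subgroup.closure (Set.range f) := hf ▸ Subgroup.mem_top q
      refine ((Subgroup.closure_le _).2 ?_) hq
      rintro _ ⟨i, rfl⟩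
      rw [SetLike.mem_coe, mem_centralizerMod]
      rcases lt_trichotomy (FreeMagma.of i) b with h | h | h
      · rw [commutator_mem_comm]
        exact spanMod_mono f _ (basicOfWeightFrom_subset _ _)
          (commutator_mem_spanMod_of_lt f (n + 1) b (.of i) hb trivial h (by rw [lb]; rfl))
      · rw [← h]
        exact (commutatorElement_self (f i)).symm ▸ one_mem _
      · exact spanMod_mono f _ (basicOfWeightFrom_subset _ _)
          (commutator_mem_spanMod_of_lt f (n + 1) (.of i) b trivial hb h
            (by rw [lb, add_comm]; rfl))
    · intro g hg
      rw [mem_centralizerMod]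
      exact gamma_le_spanMod f _ _ (commutator_mem_gamma_succ hg q)

end Spanning

/-! ### Magnus representation and leading coefficients. -/

section Magnus

open scoped commutatorElement
open PowerSeries

variable {A : Type*} [Ring A]

/-- `u = 1 + a t ^ n + …`. -/
def HasLeading (n : ℕ) (u : (PowerSeries A)ˣ) (a : A) : Prop :=
  ∃ c : PowerSeries A, (u : PowerSeries A) = 1 + X ^ n * c ∧ constantCoeff c = a

theorem constantCoeff_X_pow_mul {n : ℕ} (hn : 1 ≤ n) (c : PowerSeries A) :
    constantCoeff (X ^ n * c) = 0 := by
  rw [map_mul, map_pow, constantCoeff_X, zero_pow (by omega), zero_mul]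

namespace HasLeading

variable {n p q : ℕ} {u v : (PowerSeries A)ˣ} {a b : A}

theorem constantCoeff_eq_one (h : HasLeading n u a) (hn : 1 ≤ n) :
    constantCoeff (u : PowerSeries A) = 1 := by
  obtain ⟨c, hc, -⟩ := h
  rw [hc, map_add, constantCoeff_X_pow_mul hn, map_one, add_zero]

theorem constantCoeff_inv_eq_one (h : HasLeading n u a) (hn : 1 ≤ n) :
    constantCoeff ((u⁻¹ : (PowerSeries A)ˣ) : PowerSeries A) = 1 := by
  have h₁ : constantCoeff (((u⁻¹ : (PowerSeries A)ˣ) : PowerSeries A) * (u : PowerSeries A)) = 1 := by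
    rw [Units.inv_mul, map_one]
  rwa [map_mul, h.constantCoeff_eq_one hn, mul_one] at h₁

theorem one (n : ℕ) : HasLeading n (1 : (PowerSeries A)ˣ) 0 := ⟨0, by simp, by simp⟩

theorem mul (hn : 1 ≤ n) (hu : HasLeading n u a) (hv : HasLeading n v b) :
    HasLeading n (u * v) (a + b) := by
  obtain ⟨c, hc, rfl⟩ := hu
  obtain ⟨d, hd, rfl⟩ := hv
  refine ⟨c + d + c * (X ^ n * d), ?_, ?_⟩
  · rw [Units.val_mul, hc, hd]
    noncomm_ring
  · rw [map_add, map_add, map_mul, constantCoeff_X_pow_mul hn, mul_zero, add_zero]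

theorem inv (hn : 1 ≤ n) (hu : HasLeading n u a) : HasLeading n u⁻¹ (-a) := by
  have h₁ := hu.constantCoeff_inv_eq_one hn
  obtain ⟨c, hc, rfl⟩ := hu
  refine ⟨-(c * ((u⁻¹ : (PowerSeries A)ˣ) : PowerSeries A)), ?_, ?_⟩
  · have h₂ : (u : PowerSeries A) * ((u⁻¹ : (PowerSeries A)ˣ) : PowerSeries A) = 1 :=
      Units.mul_inv u
    rw [hc, add_mul, one_mul] at h₂
    rw [mul_neg, ← mul_assoc, ← sub_eq_add_neg, eq_sub_iff_add_eq, h₂]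
  · rw [map_neg, map_mul, h₁, mul_one]

/-- As t is central, uv - vu = t^{p+q}(cd - dc). Multiplying on the right by u⁻¹v⁻¹, which has
constant term 1, does not change the leading coefficient. -/
theorem commutator (hp : 1 ≤ p) (hq : 1 ≤ q) (hu : HasLeading p u a) (hv : HasLeading q v b) :
    HasLeading (p + q) ⁅u, v⁆ (a * b - b * a) := by
  have hu' := hu.constantCoeff_inv_eq_one hp
  have hv' := hv.constantCoeff_inv_eq_one hq
  obtain ⟨c, hc, rfl⟩ := hu
  obtain ⟨d, hd, rfl⟩ := hv
  have key : (u : PowerSeries A) * (v : PowerSeries A) =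
      (v : PowerSeries A) * (u : PowerSeries A) + X ^ (p + q) * (c * d - d * c) := by
    have h₁ : X ^ p * c * (X ^ q * d) = X ^ (p + q) * (c * d) := by
      rw [mul_assoc, ← mul_assoc c, ((commute_X c).pow_right q).eq, pow_add]
      simp only [mul_assoc]
    have h₂ : X ^ q * d * (X ^ p * c) = X ^ (p + q) * (d * c) := by
      rw [mul_assoc, ← mul_assoc d, ((commute_X d).pow_right p).eq, add_comm p q, pow_add]
      simp only [mul_assoc]
    rw [hc, hd, mul_sub, ← h₁, ← h₂]
    noncomm_ring
  refine ⟨(c * d - d * c) * ((u⁻¹ : (PowerSeries A)ˣ) : PowerSeries A) *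
    ((v⁻¹ : (PowerSeries A)ˣ) : PowerSeries A), ?_, ?_⟩
  · rw [commutatorElement_def, Units.val_mul, Units.val_mul, Units.val_mul, key, add_mul, add_mul]
    congr 1
    · rw [Units.mul_inv_cancel_right, Units.mul_inv]
    · simp only [mul_assoc]
  · rw [map_mul, map_mul, hu', hv', mul_one, mul_one, map_sub, map_mul, map_mul]

theorem of_succ (h : HasLeading (n + 1) u a) : HasLeading n u 0 := by
  obtain ⟨c, hc, -⟩ := h
  refine ⟨X * c, ?_, ?_⟩
  · rw [hc, pow_succ, mul_assoc]
  · rw [map_mul, constantCoeff_X, zero_mul]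

theorem unique (ha : HasLeading n u a) (hb : HasLeading n u b) : a = b := by
  obtain ⟨c, hc, rfl⟩ := ha
  obtain ⟨d, hd, rfl⟩ := hb
  have h := congrArg (coeff n) (add_left_cancel (hc.symm.trans hd))
  have e : ∀ c : PowerSeries A, coeff n (X ^ n * c) = constantCoeff c := fun c => by
    simpa using coeff_X_pow_mul c n 0
  rwa [e, e] at h

theorem pow (hn : 1 ≤ n) (hu : HasLeading n u a) (k : ℕ) : HasLeading n (u ^ k) (k • a) := by
  induction k with
  | zero => simpa using one n
  | succ k ih =>
    rw [pow_succ, succ_nsmul]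
    exact ih.mul hn hu

theorem zpow (hn : 1 ≤ n) (hu : HasLeading n u a) (k : ℤ) : HasLeading n (u ^ k) (k • a) := by
  cases k with
  | ofNat k => simpa using hu.pow hn k
  | negSucc k =>
    rw [zpow_negSucc, negSucc_zsmul]
    exact (hu.pow hn (k + 1)).inv hn

end HasLeading

/-- The unit `1 + a t` of the ring of power series in `t`. -/
noncomputable def magnusUnit (a : A) : (PowerSeries A)ˣ where
  val := 1 + X * C a
  inv := mk fun n => (-a) ^ n
  val_inv := by
    ext n
    cases n with
    | zero => simp [add_mul, mul_assoc]
    | succ n =>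
      rw [add_mul, one_mul, mul_assoc, map_add, coeff_succ_X_mul, coeff_C_mul, coeff_mk, coeff_mk,
        pow_succ', coeff_one, if_neg n.succ_ne_zero]
      noncomm_ring
  inv_val := by
    ext n
    cases n with
    | zero => simp [mul_add, ← mul_assoc]
    | succ n =>
      rw [mul_add, mul_one, ← (commute_X (C a)).eq, ← mul_assoc, map_add, coeff_succ_mul_X,
        coeff_mul_C, coeff_mk, coeff_mk, pow_succ, coeff_one, if_neg n.succ_ne_zero]
      noncomm_ring

theorem hasLeading_magnusUnit (a : A) : HasLeading 1 (magnusUnit a) a :=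
  ⟨C a, by rw [pow_one]; rfl, constantCoeff_C a⟩

/-- The value of a formal commutator in an associative ring. -/
def lieEval {α : Type*} (x : α → A) : FreeMagma α → A
  | .of a => x a
  | .mul u v => lieEval x u * lieEval x v - lieEval x v * lieEval x u

theorem lieEval_mul {α : Type*} (x : α → A) (u v : FreeMagma α) :
    lieEval x (u * v) = lieEval x u * lieEval x v - lieEval x v * lieEval x u := rfl

variable {α : Type*} {G : Type*} [Group G] {f : α → G} {x : α → A} {φ : G →* (PowerSeries A)ˣ}

/-- The elements sent to 1 + at^n + … form a subgroup for each n, and the commutator rule makes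
these subgroups a central filtration; the lower central series descends at least as fast. -/
theorem hasLeading_of_mem_gamma (hf : Subgroup.closure (Set.range f) = ⊤)
    (hφ : ∀ i, HasLeading 1 (φ (f i)) (x i)) {n : ℕ} (hn : 1 ≤ n) {g : G} (hg : g ∈ gamma G n) :
    ∃ a, HasLeading n (φ g) a := by
  let D : (n : ℕ) → 1 ≤ n → Subgroup G := fun n hn =>
    { carrier := {g | ∃ a, HasLeading n (φ g) a}
      one_mem' := ⟨0, by rw [map_one]; exact .one n⟩
      mul_mem' := by
        rintro g h ⟨a, ha⟩ ⟨b, hb⟩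
        exact ⟨a + b, by rw [map_mul]; exact ha.mul hn hb⟩
      inv_mem' := by
        rintro g ⟨a, ha⟩
        exact ⟨-a, by rw [map_inv]; exact ha.inv hn⟩ }
  have htop : D 1 le_rfl = ⊤ := by
    rw [eq_top_iff, ← hf, Subgroup.closure_le]
    rintro _ ⟨i, rfl⟩
    exact ⟨x i, hφ i⟩
  suffices h : gamma G n ≤ D n hn from h hg
  clear hg
  induction n, hn using Nat.le_induction with
  | base => exact htop.ge
  | succ n hn ih =>
    rw [gamma_succ hn, Subgroup.commutator_le]
    intro g hg h hh
    obtain ⟨a, ha⟩ := ih hg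
    rw [← htop] at hh
    obtain ⟨b, hb⟩ := hh
    exact ⟨_, by rw [map_commutatorElement]; exact ha.commutator hn le_rfl hb⟩

theorem hasLeading_groupEval (hφ : ∀ i, HasLeading 1 (φ (f i)) (x i)) (t : FreeMagma α) :
    HasLeading t.length (φ (groupEval f t)) (lieEval x t) := by
  induction t using FreeMagma.recOnMul with
  | ih1 a => exact hφ a
  | ih2 u v hu hv =>
    rw [groupEval_mul, map_commutatorElement]
    exact hu.commutator u.length_pos v.length_pos hv

theorem hasLeading_list_prod (hφ : ∀ i, HasLeading 1 (φ (f i)) (x i)) {n : ℕ} (hn : 1 ≤ n)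
    (e : FreeMagma α → ℤ) (l : List (FreeMagma α)) (hl : ∀ t ∈ l, t.length = n) :
    HasLeading n (φ (l.map fun t => groupEval f t ^ e t).prod)
      (l.map fun t => e t • lieEval x t).sum := by
  induction l with
  | nil => simpa using HasLeading.one n
  | cons t l ih =>
    rw [List.map_cons, List.prod_cons, List.map_cons, List.sum_cons, map_mul, map_zpow]
    rw [List.forall_mem_cons] at hl
    exact ((hl.1 ▸ hasLeading_groupEval hφ t : HasLeading n _ _).zpow hn _).mul hn (ih hl.2)

/-- The coefficient of t^n is computed twice: it is the given sum, and it is 0 because the product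
lies in γ_{n+1}. Thus a relation in γ_n/γ_{n+1} becomes a linear relation between Lie brackets. -/
theorem sum_lieEval_eq_zero (hf : Subgroup.closure (Set.range f) = ⊤)
    (hφ : ∀ i, HasLeading 1 (φ (f i)) (x i)) {n : ℕ} (hn : 1 ≤ n) (e : FreeMagma α → ℤ)
    (l : List (FreeMagma α)) (hl : ∀ t ∈ l, t.length = n)
    (h : (l.map fun t => groupEval f t ^ e t).prod ∈ gamma G (n + 1)) :
    (l.map fun t => e t • lieEval x t).sum = 0 := by
  obtain ⟨a, ha⟩ := hasLeading_of_mem_gamma hf hφ (n := n + 1) (by omega) h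
  exact (hasLeading_list_prod hφ hn e l hl).unique ha.of_succ

end Magnus

/-! ### Independence of basic commutators in the free associative algebra, by elimination. -/

section Elimination

variable {α : Type*}

/-- The total weight of a word in formal commutators. -/
def wordWeight (l : List (FreeMagma α)) : ℕ := (l.map FreeMagma.length).sum

theorem wordWeight_append (l m : List (FreeMagma α)) :
    wordWeight (l ++ m) = wordWeight l + wordWeight m := by
  simp [wordWeight]

theorem wordWeight_cons (t : FreeMagma α) (m : List (FreeMagma α)) :
    wordWeight (t :: m) = t.length + wordWeight m := by
  simp [wordWeight]

theorem wordWeight_map_of (l : List α) : wordWeight (l.map FreeMagma.of) = l.length := by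
  induction l with
  | nil => rfl
  | cons a l ih =>
    rw [List.map_cons, wordWeight_cons, ih, List.length_cons, add_comm]
    rfl

section Words

variable {A : Type*} [Ring A]

/-- The value of a word in formal commutators. -/
def wordEval (x : α → A) (l : List (FreeMagma α)) : A := (l.map (lieEval x)).prod

theorem wordEval_append (x : α → A) (l m : List (FreeMagma α)) :
    wordEval x (l ++ m) = wordEval x l * wordEval x m := by
  simp [wordEval]

theorem wordEval_cons (x : α → A) (t : FreeMagma α) (m : List (FreeMagma α)) :
    wordEval x (t :: m) = lieEval x t * wordEval x m := by
  simp [wordEval]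

/-- The span of the words of weight `m` made of a power of `z` followed by a word in `T`. -/
def powerSpan (x : α → A) (z : FreeMagma α) (T : Set (FreeMagma α)) (m : ℕ) : Submodule ℤ A :=
  Submodule.span ℤ (wordEval x ''
    {l | ∃ k w, l = List.replicate k z ++ w ∧ (∀ t ∈ w, t ∈ T) ∧ wordWeight l = m})

theorem mul_mem_powerSpan (x : α → A) (z : FreeMagma α) (T : Set (FreeMagma α)) {m : ℕ} {a : A}
    (ha : a ∈ powerSpan x z T m) : lieEval x z * a ∈ powerSpan x z T (z.length + m) := by
  suffices h : powerSpan x z T m ≤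
      (powerSpan x z T (z.length + m)).comap (LinearMap.mulLeft ℤ (lieEval x z)) from h ha
  refine Submodule.span_le.2 ?_
  rintro _ ⟨_, ⟨k, w, rfl, hw, rfl⟩, rfl⟩
  refine Submodule.subset_span ⟨_, ⟨k + 1, w, rfl, hw, ?_⟩, ?_⟩
  · rw [List.replicate_succ, List.cons_append, wordWeight_cons]
  · rw [List.replicate_succ, List.cons_append, wordEval_cons, LinearMap.mulLeft_apply]

theorem mul_word_mem_powerSpan (x : α → A) (z : FreeMagma α) {T : Set (FreeMagma α)}
    (hT : ∀ t ∈ T, t * z ∈ T) (k : ℕ) {w : List (FreeMagma α)} (hw : ∀ t ∈ w, t ∈ T)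
    {t : FreeMagma α} (ht : t ∈ T) : lieEval x t * wordEval x (List.replicate k z ++ w) ∈
      powerSpan x z T (t.length + wordWeight (List.replicate k z ++ w)) := by
  induction k generalizing t with
  | zero =>
    refine Submodule.subset_span ⟨t :: w, ⟨0, t :: w, rfl, ?_, wordWeight_cons _ _⟩,
      wordEval_cons _ _ _⟩
    exact List.forall_mem_cons.2 ⟨ht, hw⟩
  | succ k ih =>
    rw [List.replicate_succ, List.cons_append, wordEval_cons, wordWeight_cons]
    set y := wordEval x (List.replicate k z ++ w)
    -- Collecting one `z` to the left creates the bracket `t * z`, again in `T`; hence the induction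
    -- on `k` keeps `t` arbitrary.
    have e : lieEval x t * (lieEval x z * y) =
        lieEval x z * (lieEval x t * y) + lieEval x (t * z) * y := by
      rw [lieEval_mul]
      noncomm_ring
    rw [e]
    refine add_mem ?_ ?_
    · have := mul_mem_powerSpan x z T (ih ht)
      rwa [add_left_comm] at this
    · have := ih (hT t ht)
      rwa [FreeMagma.length_mul, add_assoc] at this

end Words

variable [LinearOrder α]

/-- The basic commutators outside `I` all of whose right factors are in `I`: the free generators
left after eliminating the elements of `I`. -/
def remaining (I : Finset (FreeMagma α)) : Set (FreeMagma α) :=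
  {t | IsBasicCommutator t ∧ t ∉ I ∧ ∀ p q, t = p * q → q ∈ I}

/-- The words of weight `n` made of an increasing product of elements of `I`, followed by a word
in the elements of `remaining I`. -/
def collectedWords (I : Finset (FreeMagma α)) (n : ℕ) : Set (List (FreeMagma α)) :=
  {l | ∃ s w, l = s ++ w ∧ s.Pairwise (· ≤ ·) ∧ (∀ t ∈ s, t ∈ I) ∧ (∀ t ∈ w, t ∈ remaining I) ∧
    wordWeight l = n}

/-- `I` consists of basic commutators smaller than the basic commutator `z`, and contains them
all. -/
structure IsInitial (I : Finset (FreeMagma α)) (z : FreeMagma α) : Prop where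
  basic : IsBasicCommutator z
  lt : ∀ t ∈ I, t < z
  mem : ∀ t, IsBasicCommutator t → t < z → t ∈ I

variable {I : Finset (FreeMagma α)} {z : FreeMagma α}

theorem IsInitial.notMem (h : IsInitial I z) : z ∉ I := fun hz => lt_irrefl _ (h.lt z hz)

theorem IsInitial.lt_of_basic (h : IsInitial I z) {t : FreeMagma α} (ht : IsBasicCommutator t)
    (hI : t ∉ insert z I) : z < t := by
  rw [Finset.mem_insert, not_or] at hI
  exact lt_of_le_of_ne (not_lt.1 fun h' => hI.2 (h.mem t ht h')) (Ne.symm hI.1)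

theorem IsInitial.le_of_mem (h : IsInitial I z) {t : FreeMagma α} (ht : t ∈ insert z I) :
    t ≤ z := by
  rcases Finset.mem_insert.1 ht with rfl | ht
  · exact le_rfl
  · exact (h.lt t ht).le

theorem IsInitial.mem_remaining (h : IsInitial I z) : z ∈ remaining I := by
  refine ⟨h.basic, h.notMem, ?_⟩
  rintro p q rfl
  exact h.mem q (isBasicCommutator_mul.1 h.basic).2.1 (FreeMagma.lt_mul_right p q)

theorem mem_remaining_insert {t : FreeMagma α} (ht : t ∈ remaining I)
    (hz : t ≠ z) : t ∈ remaining (insert z I) :=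
  ⟨ht.1, fun h' => (Finset.mem_insert.1 h').elim hz ht.2.1,
    fun p q e => Finset.mem_insert_of_mem (ht.2.2 p q e)⟩

theorem IsInitial.mul_mem_remaining (h : IsInitial I z) {t : FreeMagma α}
    (ht : t ∈ remaining (insert z I)) : t * z ∈ remaining (insert z I) := by
  have hlt := h.lt_of_basic ht.1 ht.2.1
  refine ⟨isBasicCommutator_mul.2 ⟨ht.1, h.basic, hlt, fun p q e => h.le_of_mem (ht.2.2 p q e)⟩,
    fun h' => ?_, fun p q e => ?_⟩
  · exact ((hlt.trans (FreeMagma.lt_mul_left t z)).trans_le (h.le_of_mem h')).false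
  · rw [← (FreeMagma.mul_inj.1 e).2]
    exact Finset.mem_insert_self z I

/-- Lazard elimination: the generators left after removing z are the brackets [u, z, …, z] with u ≠
z an earlier generator. -/
theorem IsInitial.remaining_cases (h : IsInitial I z) {t : FreeMagma α}
    (ht : t ∈ remaining (insert z I)) :
    (t ∈ remaining I ∧ t ≠ z) ∨ ∃ u ∈ remaining (insert z I), t = u * z := by
  have hz : t ≠ z := fun e => ht.2.1 (Finset.mem_insert.2 (Or.inl e))
  have hI : t ∉ I := fun e => ht.2.1 (Finset.mem_insert.2 (Or.inr e))
  cases t with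
  | of a => exact Or.inl ⟨⟨trivial, hI, fun p q e => by cases e⟩, hz⟩
  | mul u v =>
    rw [FreeMagma.mul_eq] at *
    obtain ⟨hu, -, hvu, huv⟩ := isBasicCommutator_mul.1 ht.1
    rcases Finset.mem_insert.1 (ht.2.2 u v rfl) with rfl | hv
    · refine Or.inr ⟨u, ⟨hu, fun h' => (hvu.trans_le (h.le_of_mem h')).false, ?_⟩, rfl⟩
      rintro p q rfl
      have hq := (isBasicCommutator_mul.1 hu).2.1
      rcases (huv p q rfl).eq_or_lt with rfl | hlt
      · exact Finset.mem_insert_self _ _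
      · exact Finset.mem_insert_of_mem (h.mem q hq hlt)
    · exact Or.inl ⟨⟨ht.1, hI, fun p q e => (FreeMagma.mul_inj.1 e).2 ▸ hv⟩, hz⟩

section Span

variable {A : Type*} [Ring A]

theorem IsInitial.word_mem_powerSpan (h : IsInitial I z) (x : α → A) (w : List (FreeMagma α))
    (hw : ∀ t ∈ w, t ∈ remaining I) :
    wordEval x w ∈ powerSpan x z (remaining (insert z I)) (wordWeight w) := by
  induction w with
  | nil => exact Submodule.subset_span ⟨[], ⟨0, [], rfl, by simp, rfl⟩, rfl⟩
  | cons t w ih =>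
    rw [List.forall_mem_cons] at hw
    rw [wordEval_cons, wordWeight_cons]
    by_cases hz : t = z
    · rw [hz]
      exact mul_mem_powerSpan x z _ (ih hw.2)
    · suffices h' : powerSpan x z (remaining (insert z I)) (wordWeight w) ≤
          (powerSpan x z (remaining (insert z I)) (t.length + wordWeight w)).comap
            (LinearMap.mulLeft ℤ (lieEval x t)) from h' (ih hw.2)
      refine Submodule.span_le.2 ?_
      rintro _ ⟨_, ⟨k, w', rfl, hw', e⟩, rfl⟩
      rw [← e]
      exact mul_word_mem_powerSpan x z (fun t => h.mul_mem_remaining) k hw'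
        (mem_remaining_insert hw.1 hz)

/-- Eliminating `z` does not shrink the span: its occurrences in the free part are collected to the
left and join the increasing part, of which `z` is the largest entry. -/
theorem IsInitial.span_le (h : IsInitial I z) (x : α → A) (n : ℕ) :
    Submodule.span ℤ (wordEval x '' collectedWords I n) ≤
      Submodule.span ℤ (wordEval x '' collectedWords (insert z I) n) := by
  refine Submodule.span_le.2 ?_
  rintro _ ⟨_, ⟨s, w, rfl, hs, hsI, hw, rfl⟩, rfl⟩
  rw [wordEval_append]
  suffices h' : powerSpan x z (remaining (insert z I)) (wordWeight w) ≤
      (Submodule.span ℤ (wordEval x '' collectedWords (insert z I) (wordWeight (s ++ w)))).comap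
        (LinearMap.mulLeft ℤ (wordEval x s)) from h' (h.word_mem_powerSpan x w hw)
  refine Submodule.span_le.2 ?_
  rintro _ ⟨_, ⟨k, w', rfl, hw', e⟩, rfl⟩
  refine Submodule.subset_span
    ⟨s ++ (List.replicate k z ++ w'), ⟨s ++ List.replicate k z, w', ?_, ?_, ?_, hw', ?_⟩, ?_⟩
  · rw [List.append_assoc]
  · rw [List.pairwise_append]
    refine ⟨hs, List.pairwise_replicate.2 (Or.inr le_rfl), fun a ha b hb => ?_⟩
    rw [List.eq_of_mem_replicate hb]
    exact (h.lt a (hsI a ha)).le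
  · intro t ht
    rcases List.mem_append.1 ht with ht | ht
    · exact Finset.mem_insert_of_mem (hsI t ht)
    · rw [List.eq_of_mem_replicate ht]
      exact Finset.mem_insert_self _ _
  · rw [wordWeight_append, wordWeight_append s w, e]
  · rw [wordEval_append, LinearMap.mulLeft_apply]

end Span

section Count

/-- Replaces `[u, z, …, z]` by the word `u, z, …, z`. -/
noncomputable def expand (z : FreeMagma α) : FreeMagma α → List (FreeMagma α)
  | .of a => [.of a]
  | .mul u v => if v = z then expand z u ++ [z] else [u * v]

theorem expand_mul (z u v : FreeMagma α) :
    expand z (u * v) = if v = z then expand z u ++ [z] else [u * v] := rfl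

theorem expand_mul_self (z u : FreeMagma α) : expand z (u * z) = expand z u ++ [z] := by
  rw [expand_mul, if_pos rfl]

theorem expand_eq_self {z t : FreeMagma α} (h : ∀ p, t ≠ p * z) : expand z t = [t] := by
  cases t with
  | of a => rfl
  | mul u v =>
    rw [FreeMagma.mul_eq, expand_mul, if_neg]
    rintro rfl
    exact h u rfl

theorem wordWeight_expand (z t : FreeMagma α) : wordWeight (expand z t) = t.length := by
  induction t using FreeMagma.recOnMul with
  | ih1 a => rfl
  | ih2 u v hu _ =>
    rw [expand_mul]
    split_ifs with h
    · rw [wordWeight_append, hu, h, FreeMagma.length_mul]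
      rfl
    · rfl

theorem wordWeight_flatMap_expand (z : FreeMagma α) (l : List (FreeMagma α)) :
    wordWeight (l.flatMap (expand z)) = wordWeight l := by
  induction l with
  | nil => rfl
  | cons t l ih =>
    rw [List.flatMap_cons, wordWeight_append, wordWeight_cons, ih, wordWeight_expand]

/-- Undoes `expand z`, reading a word from left to right and collecting the output in reverse. -/
noncomputable def collapseStep (z : FreeMagma α) (J : Finset (FreeMagma α)) :
    List (FreeMagma α) → FreeMagma α → List (FreeMagma α)
  | [], t => [t]
  | u :: acc, t => if t = z ∧ u ∉ J then (u * z) :: acc else t :: u :: acc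

theorem collapseStep_of_ne {J : Finset (FreeMagma α)} (acc : List (FreeMagma α))
    {t : FreeMagma α} (h : t ≠ z) : collapseStep z J acc t = t :: acc := by
  cases acc with
  | nil => rfl
  | cons u acc => rw [collapseStep, if_neg fun h' => h h'.1]

theorem collapseStep_of_forall_mem {J : Finset (FreeMagma α)} {acc : List (FreeMagma α)}
    (hacc : ∀ u ∈ acc, u ∈ J) (t : FreeMagma α) : collapseStep z J acc t = t :: acc := by
  cases acc with
  | nil => rfl
  | cons u acc => rw [collapseStep, if_neg fun h' => h'.2 (hacc u List.mem_cons_self)]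

theorem IsInitial.expand_of_mem_remaining (h : IsInitial I z) {t : FreeMagma α}
    (ht : t ∈ remaining I) : expand z t = [t] :=
  expand_eq_self fun p e => h.notMem (ht.2.2 p z e)

theorem IsInitial.expand_of_mem (h : IsInitial I z) {t : FreeMagma α} (ht : t ∈ insert z I) :
    expand z t = [t] := by
  refine expand_eq_self ?_
  rintro p rfl
  exact ((FreeMagma.lt_mul_right p z).trans_le (h.le_of_mem ht)).false

theorem IsInitial.flatMap_expand_of_mem (h : IsInitial I z) {s : List (FreeMagma α)}
    (hs : ∀ t ∈ s, t ∈ insert z I) : s.flatMap (expand z) = s := by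
  induction s with
  | nil => rfl
  | cons t s ih =>
    rw [List.forall_mem_cons] at hs
    rw [List.flatMap_cons, ih hs.2, h.expand_of_mem hs.1]
    rfl

theorem IsInitial.expand_mem_remaining (h : IsInitial I z) {t : FreeMagma α}
    (ht : t ∈ remaining (insert z I)) : ∀ u ∈ expand z t, u ∈ remaining I := by
  induction t using FreeMagma.recOnMul with
  | ih1 a =>
    rcases h.remaining_cases ht with ⟨h₁, -⟩ | ⟨u, -, e⟩
    · rw [h.expand_of_mem_remaining h₁]
      simpa using h₁
    · cases e
  | ih2 u v hu _ =>
    rcases h.remaining_cases ht with ⟨h₁, -⟩ | ⟨u', hu', e⟩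
    · rw [h.expand_of_mem_remaining h₁]
      simpa using h₁
    · obtain ⟨rfl, rfl⟩ := FreeMagma.mul_inj.1 e
      rw [expand_mul_self]
      intro w hw
      rcases List.mem_append.1 hw with hw | hw
      · exact hu hu' w hw
      · rw [List.mem_singleton.1 hw]
        exact h.mem_remaining

theorem IsInitial.foldl_expand (h : IsInitial I z) {t : FreeMagma α}
    (ht : t ∈ remaining (insert z I)) (acc : List (FreeMagma α)) :
    (expand z t).foldl (collapseStep z (insert z I)) acc = t :: acc := by
  induction t using FreeMagma.recOnMul with
  | ih1 a =>
    rcases h.remaining_cases ht with ⟨h₁, h₂⟩ | ⟨u, -, e⟩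
    · rw [h.expand_of_mem_remaining h₁]
      exact collapseStep_of_ne acc h₂
    · cases e
  | ih2 u v hu _ =>
    rcases h.remaining_cases ht with ⟨h₁, h₂⟩ | ⟨u', hu', e⟩
    · rw [h.expand_of_mem_remaining h₁]
      exact collapseStep_of_ne acc h₂
    · obtain ⟨rfl, rfl⟩ := FreeMagma.mul_inj.1 e
      rw [expand_mul_self, List.foldl_append, hu hu', List.foldl_cons, List.foldl_nil,
        collapseStep, if_pos ⟨rfl, hu'.2.1⟩]

theorem IsInitial.foldl_flatMap_expand (h : IsInitial I z) {w : List (FreeMagma α)}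
    (hw : ∀ t ∈ w, t ∈ remaining (insert z I)) (acc : List (FreeMagma α)) :
    (w.flatMap (expand z)).foldl (collapseStep z (insert z I)) acc = w.reverse ++ acc := by
  induction w generalizing acc with
  | nil => rfl
  | cons t w ih =>
    rw [List.forall_mem_cons] at hw
    rw [List.flatMap_cons, List.foldl_append, h.foldl_expand hw.1, ih hw.2]
    simp

theorem foldl_collapseStep_of_mem {J : Finset (FreeMagma α)} {s acc : List (FreeMagma α)}
    (hs : ∀ t ∈ s, t ∈ J) (hacc : ∀ t ∈ acc, t ∈ J) :
    s.foldl (collapseStep z J) acc = s.reverse ++ acc := by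
  induction s generalizing acc with
  | nil => rfl
  | cons t s ih =>
    rw [List.forall_mem_cons] at hs
    rw [List.foldl_cons, collapseStep_of_forall_mem hacc,
      ih hs.2 (List.forall_mem_cons.2 ⟨hs.1, hacc⟩)]
    simp

/-- Expansion can be undone: a letter `z` comes from a bracket exactly when the entry collected just
before it lies outside `insert z I`. In the increasing part every entry lies inside. -/
theorem IsInitial.collapse_expand (h : IsInitial I z) {n : ℕ} {l : List (FreeMagma α)}
    (hl : l ∈ collectedWords (insert z I) n) :
    ((l.flatMap (expand z)).foldl (collapseStep z (insert z I)) []).reverse = l := by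
  obtain ⟨s, w, rfl, -, hs, hw, -⟩ := hl
  rw [List.flatMap_append, List.foldl_append, h.flatMap_expand_of_mem hs,
    foldl_collapseStep_of_mem hs (by simp), h.foldl_flatMap_expand hw]
  simp

theorem IsInitial.injOn_expand (h : IsInitial I z) (n : ℕ) :
    Set.InjOn (fun l : List (FreeMagma α) => l.flatMap (expand z))
      (collectedWords (insert z I) n) := by
  intro l hl m hm e
  rw [← h.collapse_expand hl, ← h.collapse_expand hm]
  exact congrArg (fun l => (List.foldl (collapseStep z (insert z I)) [] l).reverse) e

theorem IsInitial.exists_eq_append_replicate (h : IsInitial I z) {s : List (FreeMagma α)}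
    (hs : s.Pairwise (· ≤ ·)) (hsI : ∀ t ∈ s, t ∈ insert z I) :
    ∃ s' k, s = s' ++ List.replicate k z ∧ ∀ t ∈ s', t ∈ I := by
  induction s with
  | nil => exact ⟨[], 0, rfl, by simp⟩
  | cons a s ih =>
    rw [List.forall_mem_cons] at hsI
    rw [List.pairwise_cons] at hs
    rcases Finset.mem_insert.1 hsI.1 with rfl | ha
    · refine ⟨[], s.length + 1, ?_, by simp⟩
      rw [List.nil_append, List.replicate_succ, List.cons_inj_right, List.eq_replicate_iff]
      exact ⟨rfl, fun b hb => le_antisymm (h.le_of_mem (hsI.2 b hb)) (hs.1 b hb)⟩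
    · obtain ⟨s', k, rfl, hs'⟩ := ih hs.2 hsI.2
      exact ⟨a :: s', k, rfl, List.forall_mem_cons.2 ⟨ha, hs'⟩⟩

/-- The final block of `z`'s in the increasing part moves to the free part, where `z` is still a
generator. With injectivity, eliminating `z` does not increase the number of words. -/
theorem IsInitial.mapsTo_expand (h : IsInitial I z) (n : ℕ) :
    Set.MapsTo (fun l : List (FreeMagma α) => l.flatMap (expand z))
      (collectedWords (insert z I) n) (collectedWords I n) := by
  rintro _ ⟨s, w, rfl, hs, hsI, hw, rfl⟩
  obtain ⟨s', k, rfl, hs'⟩ := h.exists_eq_append_replicate hs hsI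
  refine ⟨s', List.replicate k z ++ w.flatMap (expand z), ?_, (List.pairwise_append.1 hs).1, hs',
    ?_, wordWeight_flatMap_expand _ _⟩
  · simp only [List.flatMap_append]
    rw [← List.flatMap_append, h.flatMap_expand_of_mem hsI, List.append_assoc]
  · intro t ht
    rcases List.mem_append.1 ht with ht | ht
    · rw [List.eq_of_mem_replicate ht]
      exact h.mem_remaining
    · obtain ⟨u, hu, htu⟩ := List.mem_flatMap.1 ht
      exact h.expand_mem_remaining (hw u hu) t htu

end Count

theorem mem_remaining_empty {t : FreeMagma α} : t ∈ remaining ∅ ↔ ∃ a, t = .of a := by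
  constructor
  · rintro ⟨-, -, h⟩
    cases t with
    | of a => exact ⟨a, rfl⟩
    | mul u v => exact (Finset.notMem_empty _ (h u v rfl)).elim
  · rintro ⟨a, rfl⟩
    exact ⟨trivial, Finset.notMem_empty _, fun p q e => by cases e⟩

theorem collectedWords_empty (n : ℕ) : collectedWords (∅ : Finset (FreeMagma α)) n =
    Set.range fun v : Fin n → α => (List.ofFn v).map FreeMagma.of := by
  ext l
  constructor
  · rintro ⟨s, w, rfl, -, hs, hw, hn⟩
    obtain rfl : s = [] := List.eq_nil_iff_forall_not_mem.2 fun t ht =>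
      Finset.notMem_empty _ (hs t ht)
    rw [List.nil_append] at *
    obtain ⟨w, rfl⟩ : ∃ w' : List α, w = w'.map FreeMagma.of := by
      clear hn
      induction w with
      | nil => exact ⟨[], rfl⟩
      | cons t w ih =>
        rw [List.forall_mem_cons] at hw
        obtain ⟨a, rfl⟩ := mem_remaining_empty.1 hw.1
        obtain ⟨w', rfl⟩ := ih hw.2
        exact ⟨a :: w', rfl⟩
    rw [wordWeight_map_of] at hn
    subst hn
    exact ⟨fun i => w.get i, congrArg _ (List.ofFn_get w)⟩
  · rintro ⟨v, rfl⟩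
    refine ⟨[], _, rfl, List.Pairwise.nil, by simp, ?_, ?_⟩
    · intro t ht
      obtain ⟨a, -, rfl⟩ := List.mem_map.1 ht
      exact mem_remaining_empty.2 ⟨a, rfl⟩
    · change wordWeight (List.map FreeMagma.of (List.ofFn v)) = n
      rw [wordWeight_map_of, List.length_ofFn]

theorem collectedWords_span_card [Fintype α] {A : Type*} [Ring A] (x : α → A)
    (I : Finset (FreeMagma α)) (hI : ∀ t ∈ I, IsBasicCommutator t)
    (hI' : ∀ t ∈ I, ∀ u, IsBasicCommutator u → u < t → u ∈ I) (n : ℕ) :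
    (collectedWords I n).Finite ∧ (collectedWords I n).ncard ≤ Fintype.card α ^ n ∧
      Submodule.span ℤ (wordEval x '' collectedWords ∅ n) ≤
        Submodule.span ℤ (wordEval x '' collectedWords I n) := by
  induction I using Finset.induction_on_max with
  | empty =>
    rw [collectedWords_empty]
    refine ⟨Set.finite_range _, ?_, le_rfl⟩
    rw [← Set.image_univ]
    refine (Set.ncard_image_le Set.finite_univ).trans ?_
    rw [Set.ncard_univ, Nat.card_eq_fintype_card, Fintype.card_fun, Fintype.card_fin]
  | insert z I hlt ih =>
    have h : IsInitial I z := by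
      refine ⟨hI z (Finset.mem_insert_self _ _), hlt, fun t ht htz => ?_⟩
      exact (Finset.mem_insert.1 (hI' z (Finset.mem_insert_self _ _) t ht htz)).resolve_left htz.ne
    obtain ⟨h₁, h₂, h₃⟩ := ih (fun t ht => hI t (Finset.mem_insert_of_mem ht))
      (fun t ht u hu hut => h.mem u hu (hut.trans (hlt t ht)))
    have hfin := Set.Finite.of_injOn (h.mapsTo_expand n) (h.injOn_expand n) h₁
    exact ⟨hfin, (Set.ncard_le_ncard_of_injOn _ (h.mapsTo_expand n) (h.injOn_expand n) h₁).trans h₂,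
      h₃.trans (h.span_le x n)⟩

theorem basisFreeMonoid_apply {R X : Type*} [CommSemiring R] (w : FreeMonoid X) :
    FreeAlgebra.basisFreeMonoid R X w = (w.toList.map (FreeAlgebra.ι R)).prod := by
  have : FreeAlgebra.basisFreeMonoid R X w =
    FreeAlgebra.equivMonoidAlgebraFreeMonoid.symm (MonoidAlgebra.of R (FreeMonoid X) w) := rfl
  rw [this]
  change MonoidAlgebra.lift R (FreeAlgebra R X) (FreeMonoid X) (FreeMonoid.lift (FreeAlgebra.ι R))
    (MonoidAlgebra.of R (FreeMonoid X) w) = _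
  rw [MonoidAlgebra.lift_of, FreeMonoid.lift_apply]

/-- The basic commutators of weight `n` are linearly independent in the free associative
algebra. -/
theorem linearIndependent_lieEval [Fintype α] (n : ℕ) : LinearIndependent ℤ
    fun t : basicOfWeight α n => lieEval (FreeAlgebra.ι ℤ) (t : FreeMagma α) := by
  set x : α → FreeAlgebra ℤ α := FreeAlgebra.ι ℤ
  have hfin : {t : FreeMagma α | IsBasicCommutator t ∧ t.length ≤ n}.Finite :=
    (FreeMagma.finite_length_le n).subset fun t ht => ht.2
  let I := hfin.toFinset
  have hI : ∀ t, t ∈ I ↔ IsBasicCommutator t ∧ t.length ≤ n := fun t => by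
    simp only [I, Set.Finite.mem_toFinset]
    rfl
  obtain ⟨h₁, h₂, h₃⟩ := collectedWords_span_card x I (fun t ht => ((hI t).1 ht).1)
    (fun t ht u hu hut => (hI u).2
      ⟨hu, (FreeMagma.length_le_of_le hut.le).trans ((hI t).1 ht).2⟩) n
  have hwords : LinearIndependent ℤ fun v : Fin n → α => ((List.ofFn v).map x).prod := by
    have := (FreeAlgebra.basisFreeMonoid ℤ α).linearIndependent.comp
      (fun v : Fin n → α => FreeMonoid.ofList (List.ofFn v))
      (fun v v' h => List.ofFn_injective (FreeMonoid.ofList.injective h))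
    convert this using 2 with v
    · rw [Function.comp_apply, basisFreeMonoid_apply]
      rfl
    · rfl
    · exact Subsingleton.elim _ _
  have hsub : Submodule.span ℤ (Set.range fun v : Fin n → α => ((List.ofFn v).map x).prod) ≤
      Submodule.span ℤ (wordEval x '' collectedWords I n) := by
    refine le_trans (Submodule.span_mono ?_) h₃
    rintro _ ⟨v, rfl⟩
    refine ⟨_, (collectedWords_empty n).ge ⟨v, rfl⟩, ?_⟩
    rw [wordEval, List.map_map]
    rfl
  have := h₁.fintype
  -- There are at most |α|^n collected words, while their span contains the |α|^n independent words
  -- in the letters; a spanning family no larger than the rank is independent.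
  have hcollected : LinearIndependent ℤ fun l : collectedWords I n => wordEval x l := by
    rw [linearIndependent_iff_card_le_finrank_span, ← Nat.card_eq_fintype_card,
      Nat.card_coe_set_eq]
    refine h₂.trans ?_
    have hrange : (Set.range fun l : collectedWords I n => wordEval x l) =
        wordEval x '' collectedWords I n := (Set.image_eq_range _ _).symm
    rw [hrange, Set.finrank]
    have : Module.Finite ℤ (Submodule.span ℤ (wordEval x '' collectedWords I n)) :=
      Module.Finite.span_of_finite ℤ (h₁.image _)
    refine le_trans (le_of_eq ?_) (Submodule.finrank_mono hsub)
    rw [finrank_span_eq_card hwords, Fintype.card_fun, Fintype.card_fin]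
  have hmem : ∀ t : basicOfWeight α n, [(t : FreeMagma α)] ∈ collectedWords I n := fun t =>
    ⟨[t.1], [], rfl, List.pairwise_singleton _ _,
      by simpa using (hI t).2 ⟨t.2.1, t.2.2.le⟩, by simp, by simpa [wordWeight] using t.2.2⟩
  have := hcollected.comp (fun t : basicOfWeight α n => ⟨[(t : FreeMagma α)], hmem t⟩)
    (fun t t' h => Subtype.ext (List.singleton_injective (congrArg Subtype.val h)))
  convert this using 2 with t
  simp [wordEval]

end Elimination

/-! ### Hall–Petrescu collection and commutators of d-th powers. -/

section PowerCollection

open scoped commutatorElement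

variable {G : Type*} [Group G]

theorem mul_eq_commutator_mul (g h : G) : g * h = ⁅g, h⁆ * h * g := by
  group

/-- `0² + 1² + … + (n - 1)²`. -/
def sumSquares (n : ℕ) : ℕ := ∑ k ∈ Finset.range n, k ^ 2

theorem sumSquares_succ (n : ℕ) : sumSquares (n + 1) = sumSquares n + n * n := by
  rw [sumSquares, Finset.sum_range_succ, ← sumSquares, sq]

theorem six_mul_sumSquares (n : ℕ) : 6 * sumSquares (n + 1) = (n + 1) * (n * (2 * n + 1)) := by
  induction n with
  | zero => simp [sumSquares]
  | succ n ih =>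
    rw [sumSquares_succ, mul_add, ih]
    ring

theorem choose_succ_two (n : ℕ) : (n + 1).choose 2 = n + n.choose 2 := by
  rw [Nat.choose_succ_succ' n 1, Nat.choose_one_right]

theorem pow_mul_eq_of_iterated {a b₀ b₁ b₂ b₃ : G} (h₀ : SemiconjBy a b₀ (b₁ * b₀))
    (h₁ : SemiconjBy a b₁ (b₂ * b₁)) (h₂ : SemiconjBy a b₂ (b₃ * b₂)) (h₃ : Commute a b₃)
    (c₂₀ : Commute b₂ b₀) (c₂₁ : Commute b₂ b₁) (c₃₂ : Commute b₃ b₂) (n : ℕ) :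
    a ^ n * b₀ = b₁ ^ n * b₀ * (b₂ ^ n.choose 2 * b₃ ^ n.choose 3) * a ^ n := by
  induction n with
  | zero => simp
  | succ n ih =>
    have hs : SemiconjBy a (b₁ ^ n * b₀ * (b₂ ^ n.choose 2 * b₃ ^ n.choose 3))
        (b₂ ^ n * b₁ ^ n * (b₁ * b₀) * (b₃ ^ n.choose 2 * b₂ ^ n.choose 2 * b₃ ^ n.choose 3)) := by
      rw [← c₂₁.mul_pow, ← c₃₂.mul_pow]
      exact ((h₁.pow_right n).mul_right h₀).mul_right
        ((h₂.pow_right _).mul_right (h₃.pow_right _))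
    have hc : Commute (b₂ ^ n) (b₁ ^ n * (b₁ * b₀)) :=
      ((c₂₁.pow_pow n n).mul_right ((c₂₁.mul_right c₂₀).pow_left n))
    have hd : b₃ ^ n.choose 2 * b₂ ^ n.choose 2 = b₂ ^ n.choose 2 * b₃ ^ n.choose 2 :=
      (c₃₂.pow_pow _ _).eq
    rw [pow_succ', mul_assoc, ih, ← mul_assoc, hs.eq, hd, mul_assoc (b₂ ^ n), hc.eq,
      choose_succ_two, Nat.choose_succ_succ' n 2, pow_add b₂, pow_add b₃, pow_succ b₁]
    simp only [mul_assoc]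

theorem pow_mul_pow_eq_of_commutator {b₀ b₁ w : G} (h : b₀ * b₁ = w * b₁ * b₀)
    (hw₀ : Commute w b₀) (hw₁ : Commute w b₁) (m n : ℕ) :
    b₀ ^ n * b₁ ^ m = w ^ (n * m) * (b₁ ^ m * b₀ ^ n) := by
  have key : SemiconjBy (b₀ ^ n) b₁ (w ^ n * b₁) := by
    induction n with
    | zero => simp
    | succ n ih =>
      have h' : SemiconjBy b₀ b₁ (w * b₁) := h
      rw [pow_succ', pow_succ, mul_assoc]
      exact (SemiconjBy.mul_right (hw₀.pow_left n).symm h').mul_left ih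
  rw [(key.pow_right m).eq, (hw₁.pow_left n).mul_pow, ← pow_mul, mul_assoc]

/-- An explicit form of the Hall–Petrescu identity in a small class. -/
theorem mul_pow_eq_of_iterated {a b₀ b₁ b₂ b₃ w : G} (h₀ : SemiconjBy a b₀ (b₁ * b₀))
    (h₁ : SemiconjBy a b₁ (b₂ * b₁)) (h₂ : SemiconjBy a b₂ (b₃ * b₂)) (h₃ : Commute a b₃)
    (c₂₀ : Commute b₂ b₀) (c₂₁ : Commute b₂ b₁) (c₃₀ : Commute b₃ b₀) (c₃₁ : Commute b₃ b₁)
    (c₃₂ : Commute b₃ b₂) (h : b₀ * b₁ = w * b₁ * b₀) (hw₀ : Commute w b₀) (hw₁ : Commute w b₁)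
    (n : ℕ) : (b₀ * a) ^ n = b₁ ^ n.choose 2 * b₀ ^ n *
      (w ^ sumSquares n * (b₂ ^ n.choose 3 * b₃ ^ n.choose 4)) * a ^ n := by
  induction n with
  | zero => simp [sumSquares]
  | succ n ih =>
    set Z := w ^ sumSquares n * (b₂ ^ n.choose 3 * b₃ ^ n.choose 4) with hZ
    have hcomm : ∀ {g : G}, Commute w g → Commute b₂ g → Commute b₃ g → Commute Z g :=
      fun x y t => (x.pow_left _).mul_left ((y.pow_left _).mul_left (t.pow_left _))
    have hZ₀ := hcomm hw₀ c₂₀ c₃₀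
    have hZ₁ := hcomm hw₁ c₂₁ c₃₁
    have e₁ : Z * (b₁ ^ n * b₀) = b₁ ^ n * b₀ * Z := ((hZ₁.pow_right n).mul_right hZ₀).eq
    -- Passing `b₀ ^ n` across `b₁ ^ n` costs `w ^ (n * n)`: this is the source of the sum of
    -- squares.
    have e₂ := pow_mul_pow_eq_of_commutator h hw₀ hw₁ n n
    have hW : Commute (w ^ (n * n)) (b₁ ^ n * b₀ ^ (n + 1)) :=
      ((hw₁.pow_right _).mul_right (hw₀.pow_right _)).pow_left _
    have hd : b₃ ^ n.choose 4 * b₂ ^ n.choose 2 = b₂ ^ n.choose 2 * b₃ ^ n.choose 4 :=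
      (c₃₂.pow_pow _ _).eq
    have e₃ := pow_mul_eq_of_iterated h₀ h₁ h₂ h₃ c₂₀ c₂₁ c₃₂ n
    calc (b₀ * a) ^ (n + 1) = b₁ ^ n.choose 2 * b₀ ^ n * Z * (a ^ n * b₀) * a := by
          rw [pow_succ, ih]; simp only [mul_assoc]
      _ = b₁ ^ n.choose 2 * b₀ ^ n * (Z * (b₁ ^ n * b₀)) *
          (b₂ ^ n.choose 2 * b₃ ^ n.choose 3) * (a ^ n * a) := by
          rw [e₃]; simp only [mul_assoc]
      _ = b₁ ^ n.choose 2 * (b₀ ^ n * b₁ ^ n) * b₀ * Z *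
          (b₂ ^ n.choose 2 * b₃ ^ n.choose 3) * (a ^ n * a) := by
          rw [e₁]; simp only [mul_assoc]
      _ = b₁ ^ n.choose 2 * (w ^ (n * n) * (b₁ ^ n * b₀ ^ (n + 1))) * Z *
          (b₂ ^ n.choose 2 * b₃ ^ n.choose 3) * (a ^ n * a) := by
          rw [e₂, pow_succ b₀]; simp only [mul_assoc]
      _ = b₁ ^ n.choose 2 * b₁ ^ n * b₀ ^ (n + 1) * (w ^ (n * n) * w ^ sumSquares n) *
          (b₂ ^ n.choose 3 * (b₃ ^ n.choose 4 * b₂ ^ n.choose 2) * b₃ ^ n.choose 3) *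
          (a ^ n * a) := by
          rw [hW.eq, hZ]; simp only [mul_assoc]
      _ = _ := by
          rw [hd, choose_succ_two, Nat.choose_succ_succ' n 2, Nat.choose_succ_succ' n 3,
            sumSquares_succ, pow_succ a, ← pow_add, ← pow_add, add_comm n (n.choose 2), add_comm (n * n),
            add_comm (n.choose 2) (n.choose 3), add_comm (n.choose 3) (n.choose 4),
            pow_add b₂, pow_add b₃]
          simp only [mul_assoc]

/-- The divisibility properties of `d` that make `d`-th powers behave as in an abelian group up to
`j` further terms of the lower central series. -/
structure PowerRegular (d j : ℕ) : Prop where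
  le_five : j ≤ 5
  choose_two : j ≤ 2 ∨ d ∣ d.choose 2
  choose_three : j ≤ 3 ∨ d ∣ d.choose 3
  choose_four : j ≤ 4 ∨ d ∣ d.choose 4
  sumSquares : j ≤ 4 ∨ d ∣ sumSquares d

/-- Here b₁, b₂, b₃ and w have weights at least i+2, i+3, i+4 and i+4. Each correction factor either
already lies in γ_{i+j} or has exponent divisible by d, and then lies in `T`. The bound j ≤ 5 puts
all remaining commutators in γ_{i+j}. -/
theorem mul_pow_mul_inv_mem {T : Subgroup G} [T.Normal] {d i j : ℕ} (hd : PowerRegular d j)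
    (hi : 1 ≤ i) (hT : gamma G (i + j) ≤ T) (hpow : ∀ g ∈ gamma G (i + 1), g ^ d ∈ T)
    {a b : G} (ha : a ∈ gamma G i) (hb : b ∈ gamma G (i + 1)) :
    (b * a) ^ d * (a ^ d)⁻¹ ∈ T := by
  have hj := hd.le_five
  set b₁ := ⁅a, b⁆ with hb₁
  set b₂ := ⁅a, b₁⁆ with hb₂
  set b₃ := ⁅a, b₂⁆ with hb₃
  set w := ⁅b, b₁⁆ with hw
  have m₁ : b₁ ∈ gamma G (2 * i + 1) := commutator_mem_gamma ha hb (by omega)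
  have m₂ : b₂ ∈ gamma G (3 * i + 1) := commutator_mem_gamma ha m₁ (by omega)
  have m₃ : b₃ ∈ gamma G (4 * i + 1) := commutator_mem_gamma ha m₂ (by omega)
  have mw : w ∈ gamma G (3 * i + 2) := commutator_mem_gamma hb m₁ (by omega)
  have comm : ∀ {p q : ℕ} {g h : G}, g ∈ gamma G p → h ∈ gamma G q → i + j ≤ p + q →
      Commute (g : G ⧸ T) (h : G ⧸ T) := fun hg hh hpq =>
    (commute_mk_iff _ _ _).2 (hT (commutator_mem_gamma hg hh hpq))
  have semi : ∀ g : G, SemiconjBy (a : G ⧸ T) (g : G ⧸ T) ((⁅a, g⁆ : G) * (g : G ⧸ T)) := by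
    intro g
    rw [SemiconjBy, ← QuotientGroup.mk_mul, ← QuotientGroup.mk_mul, ← QuotientGroup.mk_mul]
    exact congrArg _ (mul_eq_commutator_mul a g)
  have kill : ∀ {g : G} {k n m : ℕ}, g ∈ gamma G n → i + 1 ≤ n → i + m ≤ n → (j ≤ m ∨ d ∣ k) →
      (g : G ⧸ T) ^ k = 1 := by
    rintro g k n m hg hn hm (h | ⟨k, rfl⟩)
    · rw [(QuotientGroup.eq_one_iff g).2 (hT (gamma_antitone (by omega) hg)), one_pow]
    · rw [pow_mul, ← QuotientGroup.mk_pow,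
        (QuotientGroup.eq_one_iff _).2 (hpow g (gamma_antitone hn hg)), one_pow]
  have key := mul_pow_eq_of_iterated (semi b) (semi b₁) (semi b₂) (comm ha m₃ (by omega))
    (comm m₂ hb (by omega)) (comm m₂ m₁ (by omega)) (comm m₃ hb (by omega))
    (comm m₃ m₁ (by omega)) (comm m₃ m₂ (by omega)) (w := (w : G ⧸ T))
    (by
      rw [← QuotientGroup.mk_mul, ← QuotientGroup.mk_mul, ← QuotientGroup.mk_mul]
      exact congrArg _ (mul_eq_commutator_mul b b₁))
    (comm mw hb (by omega)) (comm mw m₁ (by omega)) d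
  rw [kill m₁ (by omega) (by omega) hd.choose_two, kill m₂ (by omega) (by omega) hd.choose_three,
    kill m₃ (by omega) (m := 4) (by omega) hd.choose_four,
    kill mw (by omega) (m := 4) (by omega) hd.sumSquares,
    kill hb le_rfl (m := 1) le_rfl (Or.inr dvd_rfl)] at key
  rw [← QuotientGroup.eq_one_iff, QuotientGroup.mk_mul, QuotientGroup.mk_inv, QuotientGroup.mk_pow,
    QuotientGroup.mk_pow, QuotientGroup.mk_mul, key]
  simp

/-- The elements that are central modulo `T`. -/
def centerMod (T : Subgroup G) [T.Normal] : Subgroup G :=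
  (Subgroup.center (G ⧸ T)).comap (QuotientGroup.mk' T)

instance (T : Subgroup G) [T.Normal] : (centerMod T).Normal :=
  inferInstanceAs ((Subgroup.center (G ⧸ T)).comap (QuotientGroup.mk' T)).Normal

theorem mem_centerMod {T : Subgroup G} [T.Normal] {a : G} :
    a ∈ centerMod T ↔ ∀ q, ⁅a, q⁆ ∈ T := by
  rw [centerMod, Subgroup.mem_comap, Subgroup.mem_center_iff]
  constructor
  · intro h q
    rw [← commute_mk_iff]
    exact (h q).symm
  · intro h q
    obtain ⟨q, rfl⟩ := QuotientGroup.mk_surjective q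
    exact ((commute_mk_iff _ _ _).2 (h q)).eq.symm

/-- The normal subgroup generated by the `d`-th powers of `γ_i(G)` and by `γ_n(G)`. -/
def gammaPower (G : Type*) [Group G] (d i n : ℕ) : Subgroup G :=
  Subgroup.normalClosure {g | ∃ h ∈ gamma G i, h ^ d = g} ⊔ gamma G n

instance (d i n : ℕ) : (gammaPower G d i n).Normal := by
  rw [gammaPower]
  infer_instance

theorem pow_mem_gammaPower {d i : ℕ} (n : ℕ) {g : G} (hg : g ∈ gamma G i) :
    g ^ d ∈ gammaPower G d i n :=
  Subgroup.mem_sup_left (Subgroup.subset_normalClosure ⟨g, hg, rfl⟩)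

theorem gammaPower_commutator_le {d i j : ℕ} (hd : PowerRegular d j) (hi : 1 ≤ i) (hj : 1 ≤ j) :
    ⁅gammaPower G d i (i + j - 1), (⊤ : Subgroup G)⁆ ≤ gammaPower G d (i + 1) (i + j) := by
  rw [Subgroup.commutator_le]
  intro a ha q _
  revert q
  suffices h : gammaPower G d i (i + j - 1) ≤ centerMod (gammaPower G d (i + 1) (i + j)) by
    intro q _
    exact mem_centerMod.1 (h ha) q
  refine sup_le (Subgroup.normalClosure_le_normal ?_) ?_
  · rintro _ ⟨g, hg, rfl⟩
    rw [SetLike.mem_coe, mem_centerMod]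
    intro q
    -- [g^d, q] = g^d (qgq⁻¹)^{-d}, and g = [g, q] · qgq⁻¹; so the power formula is used with b =
    -- [g, q] and a = qgq⁻¹.
    have hg' : q * g * q⁻¹ ∈ gamma G i := Subgroup.Normal.conj_mem inferInstance g hg q
    have h := mul_pow_mul_inv_mem (T := gammaPower G d (i + 1) (i + j)) hd hi le_sup_right
      (fun g hg => pow_mem_gammaPower _ hg) hg' (commutator_mem_gamma_succ hg q)
    have e₁ : ⁅g, q⁆ * (q * g * q⁻¹) = g := by group
    rw [e₁, conj_pow] at h
    convert h using 1
    group
  · intro g hg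
    rw [mem_centerMod]
    intro q
    have := commutator_mem_gamma_succ hg q
    rw [Nat.sub_add_cancel (by omega)] at this
    exact Subgroup.mem_sup_right this

theorem iteratedCommutator_le_gammaPower {S : Subgroup G} {d j : ℕ} (hd : PowerRegular d j)
    (hj : 1 ≤ j) (hS : S ≤ gammaPower G d 1 j) (c : ℕ) :
    iteratedCommutator S c ≤ gammaPower G d (c + 1) (c + j) := by
  induction c with
  | zero => simpa [iteratedCommutator] using hS
  | succ c ih =>
    refine (Subgroup.commutator_mono ih le_rfl).trans ?_
    have := gammaPower_commutator_le (G := G) hd (i := c + 1) (by omega) hj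
    rwa [show c + 1 + j - 1 = c + j by omega] at this

/-- d divides d(d-1)⋯(d-k+1) = k! · C(d, k), and k! can be cancelled. -/
theorem dvd_choose_of_coprime {d k : ℕ} (hk : 1 ≤ k) (h : d.Coprime k.factorial) :
    d ∣ d.choose k := by
  refine h.dvd_of_dvd_mul_left ?_
  rw [← Nat.descFactorial_eq_factorial_mul_choose]
  obtain ⟨k, rfl⟩ := Nat.exists_eq_add_of_le' hk
  cases d with
  | zero => simp
  | succ d =>
    rw [Nat.succ_descFactorial_succ]
    exact dvd_mul_right _ _

theorem powerRegular_two (d : ℕ) : PowerRegular d 2 :=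
  ⟨by norm_num, Or.inl le_rfl, Or.inl (by norm_num), Or.inl (by norm_num), Or.inl (by norm_num)⟩

theorem powerRegular_three {d : ℕ} (h : Odd d) : PowerRegular d 3 :=
  ⟨by norm_num, Or.inr (dvd_choose_of_coprime (by norm_num) (by simpa using h)), Or.inl le_rfl,
    Or.inl (by norm_num), Or.inl (by norm_num)⟩

theorem powerRegular_of_coprime_six {d j : ℕ} (hj : j ≤ 5) (h₂ : d.Coprime 2) (h₃ : d.Coprime 3) :
    PowerRegular d j where
  le_five := hj
  choose_two := Or.inr (dvd_choose_of_coprime (by norm_num) h₂)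
  choose_three := Or.inr (dvd_choose_of_coprime (by norm_num) (h₂.mul_right h₃))
  choose_four := Or.inr (dvd_choose_of_coprime (by norm_num)
    ((h₂.mul_right h₂).mul_right (h₂.mul_right h₃) : d.Coprime (2 * 2 * (2 * 3))))
  sumSquares := by
    refine Or.inr ((h₂.mul_right h₃ : d.Coprime 6).dvd_of_dvd_mul_left ?_)
    cases d with
    | zero => simp [_root_.sumSquares]
    | succ d => exact ⟨_, six_mul_sumSquares d⟩

end PowerCollection

/-! ### d-th powers of γ_n inside [S, F, …, F], modulo γ_{n+1}. -/

section PowersInRho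

open scoped commutatorElement

variable {G : Type*} [Group G]

theorem iteratedCommutator_normal (S : Subgroup G) [S.Normal] (c : ℕ) :
    (iteratedCommutator S c).Normal := by
  induction c with
  | zero => assumption
  | succ c ih => exact Subgroup.commutator_normal _ _

theorem iteratedCommutator_antitone (S : Subgroup G) [S.Normal] :
    Antitone (iteratedCommutator S) := by
  refine antitone_nat_of_succ_le fun c => ?_
  have := iteratedCommutator_normal S c
  exact Subgroup.commutator_le_left _ _

theorem iteratedCommutator_le_gamma (S : Subgroup G) (c : ℕ) :
    iteratedCommutator S c ≤ gamma G (c + 1) := by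
  induction c with
  | zero => exact le_top
  | succ c ih =>
    rw [gamma_succ (by omega)]
    exact Subgroup.commutator_mono ih le_rfl

/-- The elements of order dividing `d` in the center of `G / T`, pulled back to `G`. -/
def torsionCenterMod (T : Subgroup G) [T.Normal] (d : ℕ) : Subgroup G where
  carrier := {a | a ∈ centerMod T ∧ a ^ d ∈ T}
  one_mem' := ⟨one_mem _, by rw [one_pow]; exact one_mem _⟩
  mul_mem' := by
    rintro a b ⟨ha, ha'⟩ ⟨hb, hb'⟩
    refine ⟨mul_mem ha hb, ?_⟩
    rw [← QuotientGroup.eq_one_iff, QuotientGroup.mk_pow] at ha' hb' ⊢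
    rw [QuotientGroup.mk_mul,
      ((commute_mk_iff T a b).2 (mem_centerMod.1 ha b)).mul_pow, ha', hb', one_mul]
  inv_mem' := by
    rintro a ⟨ha, ha'⟩
    exact ⟨inv_mem ha, by rw [inv_pow]; exact inv_mem ha'⟩

instance (T : Subgroup G) [T.Normal] (d : ℕ) : (torsionCenterMod T d).Normal where
  conj_mem := by
    rintro a ⟨ha, ha'⟩ g
    refine ⟨Subgroup.Normal.conj_mem inferInstance a ha g, ?_⟩
    rw [conj_pow]
    exact Subgroup.Normal.conj_mem inferInstance _ ha' g

theorem commutator_pow_of_commute {g q : G} (h : Commute ⁅g, q⁆ g) (n : ℕ) :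
    ⁅g ^ n, q⁆ = ⁅g, q⁆ ^ n := by
  induction n with
  | zero => simp
  | succ n ih =>
    rw [pow_succ, commutatorElement_mul_left_eq_conj_mul, ih, (h.symm.pow_left n).eq,
      mul_inv_cancel_right, ← pow_succ']

theorem commutator_pow_mem {T : Subgroup G} [T.Normal] {g q : G} (hc : ⁅g, q⁆ ∈ centerMod T)
    {n : ℕ} (h : ⁅g ^ n, q⁆ ∈ T) : ⁅g, q⁆ ^ n ∈ T := by
  rw [← QuotientGroup.eq_one_iff] at h ⊢
  rw [QuotientGroup.mk_pow]
  rw [← h]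
  exact (commutator_pow_of_commute (g := (g : G ⧸ T)) (q := (q : G ⧸ T))
    ((commute_mk_iff T _ _).2 (mem_centerMod.1 hc g)) n).symm

theorem mem_centerMod_of_mem_gamma {T : Subgroup G} [T.Normal] {n : ℕ}
    (hT : gamma G (n + 1) ≤ T) {g : G} (hg : g ∈ gamma G n) : g ∈ centerMod T :=
  mem_centerMod.2 fun q => hT (commutator_mem_gamma_succ hg q)

theorem top_commutator_le_of_generators {x y : G} (hxy : Subgroup.closure {x, y} = ⊤)
    {P : Subgroup G} [P.Normal] (h : ⁅x, y⁆ ∈ P) : ⁅(⊤ : Subgroup G), (⊤ : Subgroup G)⁆ ≤ P := by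
  have hgen : ∀ q : G, ⁅x, q⁆ ∈ P → ⁅y, q⁆ ∈ P → ∀ g : G, ⁅g, q⁆ ∈ P := by
    intro q hx hy g
    rw [← mem_centralizerMod]
    have hg : g ∈ Subgroup.closure {x, y} := hxy ▸ Subgroup.mem_top g
    refine (Subgroup.closure_le _).2 ?_ hg
    rintro _ (rfl | rfl)
    · exact mem_centralizerMod.2 hx
    · exact mem_centralizerMod.2 hy
  rw [Subgroup.commutator_le]
  intro g _ q _
  refine hgen q ?_ ?_ g <;> rw [commutator_mem_comm]
  · exact hgen x ((commutatorElement_self x).symm ▸ one_mem P) (commutator_mem_comm.1 h) q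
  · exact hgen y h ((commutatorElement_self y).symm ▸ one_mem P) q

/-- In weight 2, [x, y]^r ≡ [x^r, y] and [y, x]^s ≡ [y^s, x] give the exponent gcd(r, s) for [x, y],
which generates the derived subgroup as a normal subgroup. Higher weights follow from [g, q]^d ≡
[g^d, q]. -/
theorem pow_gcd_mem_iteratedCommutator {x y : G} (hxy : Subgroup.closure {x, y} = ⊤) {r s : ℕ}
    {S : Subgroup G} [S.Normal] (hx : x ^ r ∈ S) (hy : y ^ s ∈ S) (m : ℕ) {a : G}
    (ha : a ∈ gamma G (m + 2)) :
    a ^ Nat.gcd r s ∈ iteratedCommutator S (m + 1) ⊔ gamma G (m + 3) := by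
  induction m generalizing a with
  | zero =>
    have := iteratedCommutator_normal S 1
    set T := iteratedCommutator S 1 ⊔ gamma G 3
    have hc : ⁅x, y⁆ ∈ centerMod T := mem_centerMod_of_mem_gamma (n := 2) le_sup_right
      (commutator_mem_gamma_succ (a := 1) (Subgroup.mem_top x) y)
    have h₁ : ⁅x, y⁆ ^ r ∈ T := commutator_pow_mem hc
      (Subgroup.mem_sup_left (Subgroup.commutator_mem_commutator hx (Subgroup.mem_top y)))
    have h₂ : ⁅y, x⁆ ^ s ∈ T := commutator_pow_mem
      (by rw [← commutatorElement_inv]; exact inv_mem hc)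
      (Subgroup.mem_sup_left (Subgroup.commutator_mem_commutator hy (Subgroup.mem_top x)))
    rw [← commutatorElement_inv, inv_pow, inv_mem_iff] at h₂
    have h₃ : ⁅x, y⁆ ∈ torsionCenterMod T (Nat.gcd r s) := by
      refine ⟨hc, ?_⟩
      rw [← QuotientGroup.eq_one_iff, QuotientGroup.mk_pow] at h₁ h₂ ⊢
      exact pow_gcd_eq_one.2 ⟨h₁, h₂⟩
    exact (top_commutator_le_of_generators hxy h₃ ha).2
  | succ m ih =>
    have := iteratedCommutator_normal S (m + 1 + 1)
    set T := iteratedCommutator S (m + 1 + 1) ⊔ gamma G (m + 1 + 3)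
    suffices h : gamma G (m + 1 + 2) ≤ torsionCenterMod T (Nat.gcd r s) from (h ha).2
    rw [show m + 1 + 2 = (m + 2) + 1 by omega, gamma_succ (by omega), Subgroup.commutator_le]
    intro g hg q _
    have hc : ⁅g, q⁆ ∈ centerMod T :=
      mem_centerMod_of_mem_gamma (n := m + 3) le_sup_right (commutator_mem_gamma_succ hg q)
    refine ⟨hc, commutator_pow_mem hc ?_⟩
    rw [← mem_centralizerMod]
    refine (sup_le ?_ ?_ : iteratedCommutator S (m + 1) ⊔ gamma G (m + 3) ≤ _) (ih hg)
    · intro h hh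
      exact mem_centralizerMod.2
        (Subgroup.mem_sup_left (Subgroup.commutator_mem_commutator hh (Subgroup.mem_top q)))
    · intro h hh
      exact mem_centralizerMod.2 (Subgroup.mem_sup_right (commutator_mem_gamma_succ hh q))

end PowersInRho

/-! ### Filtered bases of abelian groups and the subgroup of d-multiples. -/

section FilteredModule

variable {M B : Type*} [AddCommGroup M] [Fintype B]

/-- A finite filtration `Fil a = ⊤ ≥ … ≥ Fil N = ⊥` of an abelian group, and a family `v` of
elements with weights such that the elements of weight `n` form a basis of `Fil n` modulo
`Fil (n + 1)`. -/
structure IsFilteredBasis (Fil : ℕ → Submodule ℤ M) (a N : ℕ) (wt : B → ℕ) (v : B → M) :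
    Prop where
  le : a ≤ N
  anti : Antitone Fil
  top : Fil a = ⊤
  bot : Fil N = ⊥
  le_wt : ∀ b, a ≤ wt b
  wt_lt : ∀ b, wt b < N
  mem : ∀ b, v b ∈ Fil (wt b)
  span : ∀ n, a ≤ n → n < N →
    Fil n ≤ Submodule.span ℤ (v '' ((Finset.univ.filter fun b => wt b = n : Finset B) : Set B)) ⊔
      Fil (n + 1)
  indep : ∀ n, a ≤ n → n < N → ∀ e : B → ℤ,
    ∑ b ∈ Finset.univ.filter (fun b => wt b = n), e b • v b ∈ Fil (n + 1) →
      ∀ b, wt b = n → e b = 0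

namespace IsFilteredBasis

variable {Fil : ℕ → Submodule ℤ M} {a N : ℕ} {wt : B → ℕ} {v : B → M}

/-- Each graded piece is free, so M/Fil n is torsion-free. -/
theorem mem_of_smul_mem (h : IsFilteredBasis Fil a N wt v) {k : ℤ} (hk : k ≠ 0) {n : ℕ}
    (ha : a ≤ n) (hN : n ≤ N) {m : M} (hm : k • m ∈ Fil n) : m ∈ Fil n := by
  induction n, ha using Nat.le_induction with
  | base => rw [h.top]; exact Submodule.mem_top
  | succ n ha ih =>
    have hm' := ih (by omega) (h.anti n.le_succ hm)
    obtain ⟨y, hy, u, hu, rfl⟩ := Submodule.mem_sup.1 (h.span n ha (by omega) hm')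
    obtain ⟨e, rfl⟩ := (Submodule.mem_span_image_finset_iff_exists_fun' ℤ).1 hy
    have h₁ : ∑ b ∈ Finset.univ.filter (fun b => wt b = n), (k * e b) • v b ∈ Fil (n + 1) := by
      have := sub_mem hm ((Fil (n + 1)).smul_mem k hu)
      rw [smul_add, add_sub_cancel_right, Finset.smul_sum] at this
      simpa only [mul_smul] using this
    have h₂ := h.indep n ha (by omega) _ h₁
    rw [Finset.sum_eq_zero, zero_add]
    · exact hu
    · intro b hb
      rw [(mul_eq_zero.1 (h₂ b (Finset.mem_filter.1 hb).2)).resolve_left hk, zero_smul]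

theorem linearIndependent (h : IsFilteredBasis Fil a N wt v) : LinearIndependent ℤ v := by
  rw [Fintype.linearIndependent_iff]
  intro e he
  suffices key : ∀ n, ∀ b, wt b = n → e b = 0 from fun b => key _ b rfl
  intro n
  induction n using Nat.strong_induction_on with
  | _ n ih =>
  intro b hb
  refine h.indep n (hb ▸ h.le_wt b) (hb ▸ h.wt_lt b) e ?_ b hb
  rw [← Finset.sum_filter_add_sum_filter_not Finset.univ (fun b => wt b = n)] at he
  rw [eq_neg_of_add_eq_zero_left he]
  refine neg_mem (Submodule.sum_mem _ fun b' hb' => ?_)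
  rcases lt_or_gt_of_ne (Finset.mem_filter.1 hb').2 with hlt | hgt
  · rw [ih _ hlt b' rfl, zero_smul]
    exact zero_mem _
  · exact Submodule.smul_mem _ _ (h.anti (by omega) (h.mem b'))

theorem top_le_span (h : IsFilteredBasis Fil a N wt v) :
    ⊤ ≤ Submodule.span ℤ (Set.range v) := by
  suffices key : ∀ k n, a ≤ n → n + k = N → Fil n ≤ Submodule.span ℤ (Set.range v) by
    rw [← h.top]
    exact key (N - a) a le_rfl (by have := h.le; omega)
  intro k
  induction k with
  | zero =>
    rintro n - rfl
    rw [add_zero] at h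
    rw [h.bot]
    exact bot_le
  | succ k ih =>
    intro n ha hn
    exact (h.span n ha (by omega)).trans (sup_le (Submodule.span_mono (Set.image_subset_range _ _))
      (ih (n + 1) (by omega) (by omega)))

/-- The basis of `M` given by a filtered basis. -/
noncomputable def basis (h : IsFilteredBasis Fil a N wt v) : Module.Basis B ℤ M :=
  .mk h.linearIndependent h.top_le_span

/-- Passes from graded to exact information. If dm - x ∈ Fil (n+1) with x = dm' in H, then m - m' ∈
Fil (n+1) by torsion-freeness, and descending induction applies to m - m'. For d = 0 cancellation
fails, but the claim is trivial. -/
theorem smul_mem (h : IsFilteredBasis Fil a N wt v) {H : Submodule ℤ M} {d : ℕ}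
    (h₁ : ∀ x ∈ H, ∃ m, x = (d : ℤ) • m)
    (h₂ : ∀ n, a ≤ n → n < N → ∀ m ∈ Fil n, ∃ x ∈ H, (d : ℤ) • m - x ∈ Fil (n + 1)) (m : M) :
    (d : ℤ) • m ∈ H := by
  by_cases hd : (d : ℤ) = 0
  · rw [hd, zero_smul]
    exact zero_mem H
  suffices key : ∀ k n, a ≤ n → n + k = N → ∀ m ∈ Fil n, (d : ℤ) • m ∈ H from
    key (N - a) a le_rfl (by have := h.le; omega) m (h.top ▸ Submodule.mem_top)
  intro k
  induction k with
  | zero =>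
    rintro n - rfl m hm
    rw [add_zero] at h
    rw [h.bot, Submodule.mem_bot] at hm
    rw [hm, smul_zero]
    exact zero_mem H
  | succ k ih =>
    intro n ha hn m hm
    obtain ⟨x, hx, hu⟩ := h₂ n ha (by omega) m hm
    obtain ⟨m', rfl⟩ := h₁ x hx
    rw [← smul_sub] at hu
    have := ih (n + 1) (by omega) (by omega) _ (h.mem_of_smul_mem hd (by omega) (by omega) hu)
    rw [smul_sub] at this
    have := add_mem this hx
    rwa [sub_add_cancel] at this

end IsFilteredBasis

theorem isSumOfMultiples_of_mulEquiv {G : Type*} [Group G] {A H : Subgroup G} {d N : ℕ}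
    (hHA : H ≤ A) (e : A ≃* Multiplicative (Fin N → ℤ))
    (he : ∀ g : A, (g : G) ∈ H ↔ ∀ i, (e g).toAdd i ∈ AddSubgroup.zmultiples (d : ℤ)) :
    IsSumOfMultiples A H d N := by
  refine ⟨⟨?_⟩, hHA, e, he⟩
  let ψ : H →* Multiplicative (Fin N → AddSubgroup.zmultiples (d : ℤ)) :=
    { toFun := fun h => Multiplicative.ofAdd fun i =>
        ⟨(e ⟨h, hHA h.2⟩).toAdd i, (he ⟨h, hHA h.2⟩).1 h.2 i⟩
      map_one' := by
        have : (⟨((1 : H) : G), hHA (1 : H).2⟩ : A) = 1 := rfl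
        simp only [this, map_one]
        rfl
      map_mul' := fun g h => by
        have : (⟨((g * h : H) : G), hHA (g * h).2⟩ : A) = ⟨g, hHA g.2⟩ * ⟨h, hHA h.2⟩ := rfl
        simp only [this, map_mul]
        rfl }
  refine MulEquiv.ofBijective ψ ⟨fun g h hgh => ?_, fun w => ?_⟩
  · have h₁ : e ⟨g, hHA g.2⟩ = e ⟨h, hHA h.2⟩ := by
      refine Multiplicative.toAdd.injective (funext fun i => ?_)
      exact congrArg Subtype.val (congrFun (Multiplicative.ofAdd.injective hgh) i)
    exact Subtype.ext (congrArg (Subtype.val : A → G) (e.injective h₁))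
  · let u : Multiplicative (Fin N → ℤ) := Multiplicative.ofAdd fun i => (w.toAdd i : ℤ)
    have hu : ((e.symm u : A) : G) ∈ H := by
      rw [he, e.apply_symm_apply]
      exact fun i => (w.toAdd i).2
    refine ⟨⟨_, hu⟩, Multiplicative.toAdd.injective (funext fun i => Subtype.ext ?_)⟩
    change (e ⟨((e.symm u : A) : G), hHA hu⟩).toAdd i = (w.toAdd i : ℤ)
    rw [Subtype.coe_eta, e.apply_symm_apply]
    rfl

theorem IsFilteredBasis.isSumOfMultiples {G : Type*} [Group G] {A H : Subgroup G} (hHA : H ≤ A)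
    (f : Additive A ≃+ M) {Fil : ℕ → Submodule ℤ M} {a N : ℕ} {wt : B → ℕ} {v : B → M}
    (h : IsFilteredBasis Fil a N wt v) {d : ℕ}
    (hd : ∀ g : A, (g : G) ∈ H ↔ ∃ m, f (.ofMul g) = (d : ℤ) • m) :
    IsSumOfMultiples A H d (Fintype.card B) := by
  let b : Module.Basis (Fin (Fintype.card B)) ℤ M := h.basis.reindex (Fintype.equivFin B)
  refine isSumOfMultiples_of_mulEquiv hHA
    (AddEquiv.toMultiplicativeRight (f.trans b.equivFun.toAddEquiv)) fun g => ?_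
  rw [hd]
  change _ ↔ ∀ i, b.equivFun (f (.ofMul g)) i ∈ _
  simp only [AddSubgroup.mem_zmultiples_iff]
  constructor
  · rintro ⟨m, hm⟩ i
    refine ⟨b.equivFun m i, ?_⟩
    rw [hm, map_smul, Pi.smul_apply, smul_eq_mul, smul_eq_mul, mul_comm]
  · intro hi
    choose w hw using hi
    refine ⟨b.equivFun.symm w, b.equivFun.injective ?_⟩
    rw [map_smul, LinearEquiv.apply_symm_apply]
    ext i
    rw [← hw, Pi.smul_apply, smul_eq_mul, smul_eq_mul, mul_comm]

end FilteredModule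

/-! ### Independence of basic commutators in the free group. -/

section FreeGroupGamma

theorem closure_range_freeGroup_of (α : Type*) :
    Subgroup.closure (Set.range (FreeGroup.of : α → FreeGroup α)) = ⊤ :=
  FreeGroup.closure_range_of α

/-- The basic commutators of weight `n` are independent in the free group modulo
`γ_{n+1}`. -/
theorem basic_independent {α : Type*} [LinearOrder α] [Fintype α] {n : ℕ} (hn : 1 ≤ n)
    (e : FreeMagma α → ℤ) (l : List (FreeMagma α)) (hl : l.Nodup)
    (hb : ∀ t ∈ l, t ∈ basicOfWeight α n)
    (h : (l.map fun t => groupEval FreeGroup.of t ^ e t).prod ∈ gamma (FreeGroup α) (n + 1)) :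
    ∀ t ∈ l, e t = 0 := by
  classical
  have h₀ := sum_lieEval_eq_zero
    (φ := FreeGroup.lift fun a => magnusUnit (FreeAlgebra.ι ℤ a)) (closure_range_freeGroup_of α)
    (fun i => by rw [FreeGroup.lift_apply_of]; exact hasLeading_magnusUnit _) hn e l
    (fun t ht => (hb t ht).2) h
  rw [← List.sum_toFinset _ hl] at h₀
  have hind : LinearIndepOn ℤ (lieEval (FreeAlgebra.ι ℤ)) (basicOfWeight α n) :=
    linearIndependent_lieEval n
  intro t ht
  exact linearIndepOn_iff'.1 hind l.toFinset e (fun t ht => hb t (List.mem_toFinset.1 ht)) h₀ t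
    (List.mem_toFinset.2 ht)

end FreeGroupGamma

/-! ### The basis of γ_a/γ_N formed by basic commutators. -/

section GammaFiltration

variable {G M : Type*} [Group G] [AddCommGroup M] {a N : ℕ} (p : gamma G a →* Multiplicative M)

/-- The image of `γ_n(G)` in an abelian quotient of `γ_a(G)`. -/
def gammaFil (n : ℕ) : Submodule ℤ M :=
  AddSubgroup.toIntSubmodule
    (Subgroup.toAddSubgroup' (((gamma G n).subgroupOf (gamma G a)).map p))

theorem mem_gammaFil {n : ℕ} {m : M} :
    m ∈ gammaFil p n ↔ ∃ g : gamma G a, (g : G) ∈ gamma G n ∧ (p g).toAdd = m := Iff.rfl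

theorem gammaFil_anti : Antitone (gammaFil p) := by
  rintro n n' h m ⟨g, hg, rfl⟩
  exact ⟨g, gamma_antitone h hg, rfl⟩

variable {p}

theorem mem_gamma_of_mem_gammaFil (hp : ∀ g : gamma G a, p g = 1 ↔ (g : G) ∈ gamma G N) {n : ℕ}
    (hn : n ≤ N) {g : gamma G a} (h : (p g).toAdd ∈ gammaFil p n) : (g : G) ∈ gamma G n := by
  obtain ⟨g', hg', e⟩ := (mem_gammaFil p).1 h
  have e' : p g' = p g := e
  have h₁ : p (g'⁻¹ * g) = 1 := by rw [map_mul, map_inv, e', inv_mul_cancel]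
  have h₂ := mul_mem hg' (gamma_antitone hn ((hp _).1 h₁))
  simpa using h₂

variable {α : Type*} [LinearOrder α]

/-- The basic commutators of weights `a, …, N - 1`. -/
abbrev BasicRange (α : Type*) [LinearOrder α] (a N : ℕ) : Type _ :=
  {t : FreeMagma α // IsBasicCommutator t ∧ a ≤ t.length ∧ t.length < N}

instance [Finite α] : Finite (BasicRange α a N) :=
  ((FreeMagma.finite_length_le N).subset fun _ ht => ht.2.2.le :
    {t : FreeMagma α | IsBasicCommutator t ∧ a ≤ t.length ∧ t.length < N}.Finite).to_subtype

/-- The value of a basic commutator of weight at least `a` in `γ_a(G)`. -/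
def basicValue (f : α → G) (b : BasicRange α a N) : gamma G a :=
  ⟨groupEval f b.1, gamma_antitone b.2.2.1 (groupEval_mem_gamma f b.1)⟩

theorem isFilteredBasis_gammaFil [Fintype α] [Fintype (BasicRange α a N)]
    {p : gamma (FreeGroup α) a →* Multiplicative M} (ha : 1 ≤ a) (haN : a ≤ N)
    (hsurj : Function.Surjective p)
    (hp : ∀ g : gamma (FreeGroup α) a, p g = 1 ↔ (g : FreeGroup α) ∈ gamma (FreeGroup α) N) :
    IsFilteredBasis (gammaFil p) a N (fun b : BasicRange α a N => b.1.length)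
      (fun b => (p (basicValue FreeGroup.of b)).toAdd) where
  le := haN
  anti := gammaFil_anti p
  top := by
    rw [eq_top_iff]
    rintro m -
    obtain ⟨g, hg⟩ := hsurj (Multiplicative.ofAdd m)
    exact ⟨g, g.2, hg⟩
  bot := by
    rw [eq_bot_iff]
    rintro m ⟨g, hg, rfl⟩
    exact (hp g).2 hg
  le_wt b := b.2.2.1
  wt_lt b := b.2.2.2
  mem b := ⟨basicValue FreeGroup.of b, groupEval_mem_gamma _ b.1, rfl⟩
  span n hn hnN := by
    set W : Submodule ℤ M := Submodule.span ℤ ((fun b : BasicRange α a N =>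
      (p (basicValue FreeGroup.of b)).toAdd) ''
        ((Finset.univ.filter fun b => b.1.length = n : Finset (BasicRange α a N)) : Set _)) ⊔
      gammaFil p (n + 1)
    rintro m ⟨g, hg, rfl⟩
    have hspan : spanMod FreeGroup.of n (basicOfWeight α n) ≤
        (W.toAddSubgroup.toSubgroup.comap p).map (gamma (FreeGroup α) a).subtype := by
      refine spanMod_le_iff.2 ⟨fun t ht => ?_, fun u hu => ?_⟩
      · let b : BasicRange α a N := ⟨t, ht.1, by rw [ht.2]; exact hn, by rw [ht.2]; exact hnN⟩
        refine ⟨basicValue FreeGroup.of b, ?_, rfl⟩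
        exact Submodule.mem_sup_left (Submodule.subset_span ⟨b, by simpa using ht.2, rfl⟩)
      · exact ⟨⟨u, gamma_antitone (by omega) hu⟩, Submodule.mem_sup_right ⟨_, hu, rfl⟩, rfl⟩
    obtain ⟨g', hg', e⟩ := hspan
      (gamma_le_spanMod_basic FreeGroup.of (closure_range_freeGroup_of α) n (by omega) hg)
    rw [← Subtype.ext e]
    exact hg'
  indep n hn hnN e he b hb := by
    classical
    set s : Finset (BasicRange α a N) := Finset.univ.filter fun b => b.1.length = n
    let P : gamma (FreeGroup α) a :=
      (s.toList.map fun b => basicValue FreeGroup.of b ^ e b).prod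
    have hP : (p P).toAdd = ∑ b ∈ s, e b • (p (basicValue FreeGroup.of b)).toAdd := by
      rw [map_list_prod, List.map_map, ← Finset.sum_map_toList, toAdd_list_sum, List.map_map]
      congr 2
      funext b
      simp
    rw [← hP] at he
    have hmem := mem_gamma_of_mem_gammaFil hp (by omega) he
    -- Exponents are extended by 0, since `basic_independent` takes them on all formal commutators.
    let e' : FreeMagma α → ℤ := fun t =>
      if h : IsBasicCommutator t ∧ a ≤ t.length ∧ t.length < N then e ⟨t, h⟩ else 0
    have he' : ∀ b : BasicRange α a N, e' b.1 = e b := fun b => dif_pos b.2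
    have hP' : (P : FreeGroup α) =
        ((s.toList.map Subtype.val).map fun t => groupEval FreeGroup.of t ^ e' t).prod := by
      rw [SubmonoidClass.coe_list_prod, List.map_map, List.map_map]
      congr 2
      funext b
      simp only [Function.comp_apply, he']
      rfl
    rw [hP'] at hmem
    rw [← he']
    refine basic_independent (by omega) e' _ (s.nodup_toList.map Subtype.val_injective) ?_ hmem b.1
      (List.mem_map_of_mem (by simpa [s] using hb))
    intro t ht
    obtain ⟨b', hb', rfl⟩ := List.mem_map.1 ht
    exact ⟨b'.2.1, by simpa [s] using hb'⟩

theorem card_basicRange [Fintype (BasicRange (Fin 2) a N)] :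
    Fintype.card (BasicRange (Fin 2) a N) = ∑ n ∈ Finset.Ico a N, numBasic n := by
  classical
  rw [Fintype.card, Finset.card_eq_sum_card_fiberwise (f := fun b => b.1.length)
    (t := Finset.Ico a N) (fun b _ => by simpa using b.2.2)]
  refine Finset.sum_congr rfl fun n hn => ?_
  rw [numBasic, ← Set.ncard_coe_finset, ← Set.ncard_image_of_injective _ Subtype.val_injective]
  congr 1
  rw [Finset.mem_Ico] at hn
  ext t
  constructor
  · rintro ⟨b, hb, rfl⟩
    exact ⟨b.2.1, by simpa using hb⟩
  · rintro ⟨ht, rfl⟩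
    exact ⟨⟨t, ht, hn⟩, by simp, rfl⟩

end GammaFiltration

/-! ### The image of ρ_{c+1}(S) and the final cases. -/

section Main

theorem closure_F2 : Subgroup.closure {F2.x, F2.y} = (⊤ : Subgroup F2) := by
  rw [← closure_range_freeGroup_of]
  congr 1
  ext g
  simp only [Set.mem_insert_iff, Set.mem_singleton_iff, Set.mem_range, Fin.exists_fin_two]
  exact or_congr eq_comm eq_comm

theorem powerClosure_le_gammaPower (r s j : ℕ) :
    powerClosure r s ≤ gammaPower F2 (Nat.gcd r s) 1 j := by
  refine Subgroup.normalClosure_le_normal ?_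
  rintro _ (rfl | rfl)
  · obtain ⟨k, hk⟩ := Nat.gcd_dvd_left r s
    rw [SetLike.mem_coe]
    nth_rw 2 [hk]
    rw [mul_comm, pow_mul]
    exact pow_mem_gammaPower j (Subgroup.mem_top _)
  · obtain ⟨k, hk⟩ := Nat.gcd_dvd_right r s
    rw [SetLike.mem_coe]
    nth_rw 2 [hk]
    rw [mul_comm, pow_mul]
    exact pow_mem_gammaPower j (Subgroup.mem_top _)

theorem exists_smul_of_mem_gammaPower {G M : Type*} [Group G] [AddCommGroup M] {a N d : ℕ}
    {p : gamma G a →* Multiplicative M} (haN : a ≤ N)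
    (hp : ∀ g : gamma G a, p g = 1 ↔ (g : G) ∈ gamma G N) {g : gamma G a}
    (hg : (g : G) ∈ gammaPower G d a N) : ∃ m, (p g).toAdd = (d : ℤ) • m := by
  let W : Submodule ℤ M := LinearMap.range (LinearMap.lsmul ℤ M (d : ℤ))
  have hle : gammaPower G d a N ≤
      (W.toAddSubgroup.toSubgroup.comap p).map (gamma G a).subtype := by
    refine sup_le ((Subgroup.closure_le _).2 ?_) fun u hu => ?_
    · intro z hz
      obtain ⟨_, ⟨h, hh, rfl⟩, hconj⟩ := Group.mem_conjugatesOfSet_iff.1 hz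
      obtain ⟨q, rfl⟩ := isConj_iff.1 hconj
      -- Conjugates of d-th powers are d-th powers, so the normal closure is generated by elements
      -- with image in dM.
      rw [← conj_pow]
      let u : gamma G a := ⟨q * h * q⁻¹, Subgroup.Normal.conj_mem inferInstance h hh q⟩
      refine ⟨u ^ d, ⟨(p u).toAdd, ?_⟩, rfl⟩
      rw [map_pow]
      exact natCast_zsmul _ d
    · refine ⟨⟨u, gamma_antitone haN hu⟩, ?_, rfl⟩
      rw [SetLike.mem_coe, Subgroup.mem_comap, (hp _).2 hu]
      exact one_mem _
  obtain ⟨g', ⟨m, hm⟩, e⟩ := hle hg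
  rw [← Subtype.ext e]
  exact ⟨m, hm.symm⟩

variable {M : Type*} [AddCommGroup M]

theorem mem_rho_iff_exists_smul {r s c j : ℕ} (hc : 1 ≤ c) (hj : 1 ≤ j)
    (hd : PowerRegular (Nat.gcd r s) j) {p : gamma F2 (c + 1) →* Multiplicative M}
    (hsurj : Function.Surjective p)
    (hp : ∀ g : gamma F2 (c + 1), p g = 1 ↔ (g : F2) ∈ gamma F2 (c + j)) (g : gamma F2 (c + 1)) :
    (g : F2) ∈ gamma F2 (c + j) ⊔ rho (powerClosure r s) (c + 1) ↔
      ∃ m, (p g).toAdd = (Nat.gcd r s : ℤ) • m := by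
  have := Fintype.ofFinite (BasicRange (Fin 2) (c + 1) (c + j))
  have hfil := isFilteredBasis_gammaFil (by omega) (by omega) hsurj hp
  set R := gamma F2 (c + j) ⊔ iteratedCommutator (powerClosure r s) c with hR
  have hRle : R ≤ gammaPower F2 (Nat.gcd r s) (c + 1) (c + j) :=
    sup_le le_sup_right
      (iteratedCommutator_le_gammaPower hd hj (powerClosure_le_gammaPower r s j) c)
  change (g : F2) ∈ R ↔ _
  refine ⟨fun hg => exists_smul_of_mem_gammaPower (by omega) hp (hRle hg), ?_⟩
  rintro ⟨m, hm⟩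
  let H : Submodule ℤ M := AddSubgroup.toIntSubmodule
    (Subgroup.toAddSubgroup' ((R.subgroupOf (gamma F2 (c + 1))).map p))
  have hH : (Nat.gcd r s : ℤ) • m ∈ H := by
    refine hfil.smul_mem ?_ ?_ m
    · rintro x ⟨h, hh, rfl⟩
      exact exists_smul_of_mem_gammaPower (by omega) hp (hRle hh)
    · rintro n hn hnN m ⟨h, hh, rfl⟩
      obtain ⟨k, rfl⟩ : ∃ k, n = k + 2 := ⟨n - 2, by omega⟩
      have hpow := pow_gcd_mem_iteratedCommutator closure_F2 (r := r) (s := s)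
        (S := powerClosure r s) (Subgroup.subset_normalClosure (Or.inl rfl))
        (Subgroup.subset_normalClosure (Or.inr rfl)) k hh
      obtain ⟨y, hy, u, hu, e⟩ := Subgroup.mem_sup_of_normal_right.1 hpow
      -- Here `k + 1 = n - 1 ≥ c`: weight n ≥ c + 1 uses at least c commutations with F.
      have hyR : y ∈ R := Subgroup.mem_sup_right (iteratedCommutator_antitone _ (by omega) hy)
      have hya : y ∈ gamma F2 (c + 1) :=
        gamma_antitone (by omega) (iteratedCommutator_le_gamma _ _ hy)
      have hua : u ∈ gamma F2 (c + 1) := gamma_antitone (by omega) hu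
      refine ⟨(p ⟨y, hya⟩).toAdd, ⟨⟨y, hya⟩, hyR, rfl⟩, ⟨⟨u, hua⟩, hu, ?_⟩⟩
      have e' : h ^ Nat.gcd r s = ⟨y, hya⟩ * ⟨u, hua⟩ := Subtype.ext e.symm
      have e'' := congrArg (fun z => (p z).toAdd) e'
      simp only [map_pow, map_mul, toAdd_pow, toAdd_mul] at e''
      change (p ⟨u, hua⟩).toAdd = (Nat.gcd r s : ℤ) • (p h).toAdd - (p ⟨y, hya⟩).toAdd
      rw [natCast_zsmul, e'', add_sub_cancel_left]
  obtain ⟨g', hg', e⟩ := hH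
  have e' : p g' = p g := e.trans hm.symm
  have h₁ : p (g'⁻¹ * g) = 1 := by rw [map_mul, map_inv, e', inv_mul_cancel]
  have h₂ := mul_mem (show (g' : F2) ∈ R from hg') (Subgroup.mem_sup_left ((hp _).1 h₁))
  simpa using h₂

theorem isSumOfMultiples_rho {r s c j : ℕ} (hc : 1 ≤ c) (hj : 1 ≤ j)
    (hd : PowerRegular (Nat.gcd r s) j)
    (hcomm : ⁅gamma F2 (c + 1), gamma F2 (c + 1)⁆ ≤ gamma F2 (c + j)) :
    IsSumOfMultiples
      (modGamma (c + j) (gamma F2 (c + 1)))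
      (modGamma (c + j) (rho (powerClosure r s) (c + 1)))
      (Nat.gcd r s) (∑ i ∈ Finset.Icc 1 (j - 1), numBasic (c + i)) := by
  set A := modGamma (c + j) (gamma F2 (c + 1)) with hA
  have hsup : gamma F2 (c + j) ⊔ gamma F2 (c + 1) = gamma F2 (c + 1) :=
    sup_eq_right.2 (gamma_antitone (by omega))
  have hex : ∀ x : A, ∃ g ∈ gamma F2 (c + 1), (g : F2 ⧸ gamma F2 (c + j)) = x := by
    rintro ⟨x, g, hg, rfl⟩
    exact ⟨g, hsup ▸ hg, rfl⟩
  let _ : CommGroup A :=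
    { (inferInstance : Group A) with
      mul_comm := by
        intro x y
        obtain ⟨g, hg, hx⟩ := hex x
        obtain ⟨h, hh, hy⟩ := hex y
        refine Subtype.ext ?_
        change (x : F2 ⧸ gamma F2 (c + j)) * y = y * x
        rw [← hx, ← hy]
        exact ((commute_mk_iff _ g h).2 (hcomm (Subgroup.commutator_mem_commutator hg hh))).eq }
  let p : gamma F2 (c + 1) →* Multiplicative (Additive A) :=
    { toFun := fun g => Multiplicative.ofAdd (Additive.ofMul ⟨(g : F2 ⧸ gamma F2 (c + j)),
        ⟨g, Subgroup.mem_sup_right g.2, rfl⟩⟩)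
      map_one' := rfl
      map_mul' := fun _ _ => rfl }
  have hsurj : Function.Surjective p := by
    intro x
    obtain ⟨g, hg, e⟩ := hex x.toAdd.toMul
    exact ⟨⟨g, hg⟩, Subtype.ext e⟩
  have hp : ∀ g : gamma F2 (c + 1), p g = 1 ↔ (g : F2) ∈ gamma F2 (c + j) := by
    intro g
    rw [← QuotientGroup.eq_one_iff]
    exact Subtype.ext_iff (a1 := (p g).toAdd.toMul) (a2 := 1)
  have hHA : modGamma (c + j) (rho (powerClosure r s) (c + 1)) ≤ A :=
    Subgroup.map_mono (sup_le_sup_left (iteratedCommutator_le_gamma _ c) _)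
  have := Fintype.ofFinite (BasicRange (Fin 2) (c + 1) (c + j))
  have hfil := isFilteredBasis_gammaFil (by omega) (by omega) hsurj hp
  have hcard : Fintype.card (BasicRange (Fin 2) (c + 1) (c + j)) =
      ∑ i ∈ Finset.Icc 1 (j - 1), numBasic (c + i) := by
    have hIcc : Finset.Icc 1 (j - 1) = Finset.Ico 1 j := by
      ext i
      rw [Finset.mem_Icc, Finset.mem_Ico]
      omega
    rw [card_basicRange, hIcc, Finset.sum_Ico_add numBasic 1 j c, add_comm 1 c, add_comm j c]
  rw [← hcard]
  refine hfil.isSumOfMultiples hHA (AddEquiv.refl (Additive A)) fun x => ?_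
  obtain ⟨g, hg, e⟩ := hex x
  have hx : p ⟨g, hg⟩ = Multiplicative.ofAdd (Additive.ofMul x) := Subtype.ext e
  have key := mem_rho_iff_exists_smul hc hj hd hsurj hp ⟨g, hg⟩
  rw [hx] at key
  refine Iff.trans ?_ key
  rw [← e]
  constructor
  · rintro ⟨h, hh, e'⟩
    have h₁ := QuotientGroup.eq.1 e'
    have h₂ := mul_mem hh (Subgroup.mem_sup_left h₁)
    simpa using h₂
  · exact fun h => ⟨g, h, rfl⟩

open scoped commutatorElement in
-- Additivity of weights only gives γ_4. But γ_2 is generated modulo γ_3 by the single element [x,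
-- y], which commutes with itself, and [γ_2, γ_3] ≤ γ_5.
theorem gamma_two_commutator_le : ⁅gamma F2 2, gamma F2 2⁆ ≤ gamma F2 5 := by
  set w : F2 := ⁅F2.x, F2.y⁆
  have hw : w ∈ gamma F2 2 := commutator_mem_gamma_succ (a := 1) (Subgroup.mem_top _) _
  have hle : Subgroup.closure {w} ⊔ gamma F2 3 ≤ gamma F2 2 :=
    sup_le ((Subgroup.closure_le _).2 (Set.singleton_subset_iff.2 hw)) (gamma_antitone (by norm_num))
  have hnormal : (Subgroup.closure {w} ⊔ gamma F2 3).Normal :=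
    normal_of_gamma_le (n := 2) le_sup_right hle
  have hgen : gamma F2 2 ≤ Subgroup.closure {w} ⊔ gamma F2 3 :=
    top_commutator_le_of_generators closure_F2
      (Subgroup.mem_sup_left (Subgroup.mem_closure_singleton_self w))
  have key : ∀ q ∈ gamma F2 2, ⁅w, q⁆ ∈ gamma F2 5 → ∀ g ∈ gamma F2 2, ⁅g, q⁆ ∈ gamma F2 5 := by
    intro q hq hwq g hg
    rw [← mem_centralizerMod]
    refine (sup_le ((Subgroup.closure_le _).2 (Set.singleton_subset_iff.2 ?_)) fun u hu => ?_ :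
      Subgroup.closure {w} ⊔ gamma F2 3 ≤ _) (hgen hg)
    · exact mem_centralizerMod.2 hwq
    · exact mem_centralizerMod.2 (commutator_mem_gamma hu hq le_rfl)
  rw [Subgroup.commutator_le]
  intro g hg q hq
  refine key q hq ?_ g hg
  rw [commutator_mem_comm]
  exact key w hw ((commutatorElement_self w).symm ▸ one_mem _) q hq

theorem gamma_commutator_self_le {c j : ℕ} (h : j ≤ c + 2) :
    ⁅gamma F2 (c + 1), gamma F2 (c + 1)⁆ ≤ gamma F2 (c + j) :=
  (gamma_commutator_le _ _).trans (gamma_antitone (by omega))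

theorem coprime_gcd_of_not_dvd {r s q : ℕ} (hq : q.Prime) (hr : ¬ q ∣ r) :
    (Nat.gcd r s).Coprime q :=
  ((hq.coprime_iff_not_dvd.2 fun h => hr (h.trans (Nat.gcd_dvd_left r s)))).symm

theorem proposition2p2 (r s c : ℕ) (hc : 1 ≤ c) :
    -- part (i)
    IsSumOfMultiples
      (modGamma (c + 2) (gamma F2 (c + 1)))
      (modGamma (c + 2) (rho (powerClosure r s) (c + 1)))
      (Nat.gcd r s) (numBasic (c + 1)) ∧
    -- part (ii)
    (∀ j : ℕ,
      (j = 3 ∧ Odd r ∧ Odd s) ∨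
      (j = 4 ∧ (¬ 2 ∣ r ∧ ¬ 3 ∣ r) ∧ (¬ 2 ∣ s ∧ ¬ 3 ∣ s)) ∨
      (j = 5 ∧ 3 ≤ c ∧ (¬ 2 ∣ r ∧ ¬ 3 ∣ r) ∧ (¬ 2 ∣ s ∧ ¬ 3 ∣ s)) →
      IsSumOfMultiples
        (modGamma (c + j) (gamma F2 (c + 1)))
        (modGamma (c + j) (rho (powerClosure r s) (c + 1)))
        (Nat.gcd r s) (∑ i ∈ Finset.Icc 1 (j - 1), numBasic (c + i))) := by
  constructor
  · have h := isSumOfMultiples_rho hc (j := 2) (by norm_num) (powerRegular_two (Nat.gcd r s))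
      (gamma_commutator_self_le (by omega))
    simpa using h
  · rintro j (⟨rfl, hr, -⟩ | ⟨rfl, ⟨h₂, h₃⟩, -⟩ | ⟨rfl, hc', ⟨h₂, h₃⟩, -⟩)
    · exact isSumOfMultiples_rho hc (by norm_num)
        (powerRegular_three (hr.of_dvd_nat (Nat.gcd_dvd_left r s)))
        (gamma_commutator_self_le (by omega))
    · refine isSumOfMultiples_rho hc (by norm_num)
        (powerRegular_of_coprime_six (by norm_num) (coprime_gcd_of_not_dvd Nat.prime_two h₂)
          (coprime_gcd_of_not_dvd Nat.prime_three h₃)) ?_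
      -- The weight bound 2c + 2 ≥ c + 4 fails only for c = 1, where having two generators helps.
      obtain rfl | hc := hc.eq_or_lt
      · exact gamma_two_commutator_le
      · exact gamma_commutator_self_le (by omega)
    · exact isSumOfMultiples_rho hc (by norm_num)
        (powerRegular_of_coprime_six (by norm_num) (coprime_gcd_of_not_dvd Nat.prime_two h₂)
          (coprime_gcd_of_not_dvd Nat.prime_three h₃))
        (gamma_commutator_self_le (by omega))

end Main
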